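/- Model. A radio network is a finite simple graph $G$ on $n$ nodes. In each timestep every node sleeps, listens, or sends a message; a listening node $v$ receives a message iff exactly one of its neighbours sends in that timestep, and it cannot distinguish silence from a collision. Sending and listening cost one unit of energy each; sleeping and local computation are free. Nodes know $n$, run identical code, and have distinct IDs. Algorithm. Let $C>0$ be a constant, $t_{\max}=Cn\log n$ (natural logarithm) and $$r(t)=\frac{3C\log n}{4C\log n+t_{\max}-t}.$$ Time is divided into rounds of three timesteps, numbered by the integers $t$ with $1\le t\le t_{\max}$, after which the nodes terminate. Every node starts with $\mathtt{partner}=\mathrm{null}$. In round $t$ a node with a partner sleeps. A node without a partner draws $x\in[0,1]$ uniformly, independently of all other draws; it recruits if $x\le r(t)/2$, accepts if $r(t)/2<x\le r(t)$, and sleeps for the round otherwise. * Recruiting, with ID $a$: send $a$ in timestep 1; listen in timestep 2; if a pair $(x,y)$ with $x=a$ is received, set $\mathtt{partner}=y$ and send $(x,y)$ in timestep 3, otherwise sleep in timestep 3. * Accepting, with ID $b$: listen in timestep 1; if an ID $x$ is received, send $(x,b)$ in timestep 2 and listen in timestep 3, and if then a pair $(x',y')$ with $y'=b$ is received, set $\mathtt{partner}=x'$.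 If nothing is received in timestep 1, sleep in timesteps 2 and 3. Theorem. There is an absolute constant $C_0>0$ such that the following holds for every constant $C\ge C_0$, every $n$, and every graph $G$ on $n$ vertices with any assignment of distinct IDs. Whatever the random draws are, the algorithm terminates within $3Cn\log n=O(n\log n)$ timesteps, and there is then a matching $M$ of $G$ such that every node's variable $\mathtt{partner}$ holds the ID of its partner in $M$, or null if the node is unmatched in $M$. Furthermore, $$\Pr\bigl[M\text{ is a maximal matching and every node used energy}\le 20\,C\log^2 n\bigr]\ \ge\ 1-\frac1{n^2}.$$ (For $n=0$ the right-hand side is read as $1$.) -/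

import Mathlib

open MeasureTheory ProbabilityTheory

/-- What a node does with its transceiver in one timestep. -/
inductive RadioAction (μ : Type) : Type
  | sleep : RadioAction μ
  | listen : RadioAction μ
  | send (m : μ) : RadioAction μ

/-- Sending and listening cost one unit of energy each, sleeping is free. -/
def RadioAction.cost {μ : Type} : RadioAction μ → ℕ
  | .sleep => 0
  | .listen => 1
  | .send _ => 1

/-- The (identical) code run by every node of a radio network; `σ` is the type of local states and
`μ` the type of messages.  In each timestep a node does some free local computation with a fresh
private random number (`prepare`), performs one action (`action`), and does some free local
computation with the message it received, if any (`receive`). -/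
structure RadioProgram (σ μ : Type) where
  start : ℕ → σ
  prepare : σ → ℝ → σ
  action : σ → RadioAction μ
  receive : σ → Option μ → σ

/-- When the nodes of `G` perform the actions `act`, node `v` receives the message `m`: it listens,
some neighbour sends `m`, and no other neighbour sends anything. -/
def Receives {V : Type*} {μ : Type} (G : SimpleGraph V) (act : V → RadioAction μ) (v : V) (m : μ) :
    Prop :=
  act v = .listen ∧
    ∃ u, G.Adj v u ∧ act u = .send m ∧ ∀ w, G.Adj v w → w ≠ u → ∀ m', act w ≠ .send m'

open Classical in
/-- The input of node `v` at the end of a timestep.  Silence and collision are both `none`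
(no collision detection). -/
noncomputable def heard {V : Type*} {μ : Type} (G : SimpleGraph V) (act : V → RadioAction μ)
    (v : V) : Option μ :=
  if h : ∃ m, Receives G act v m then some h.choose else none

theorem heard_eq_some_iff {V : Type*} {μ : Type} (G : SimpleGraph V) (act : V → RadioAction μ)
    (v : V) (m : μ) : heard G act v = some m ↔ Receives G act v m := by
  have uniq : ∀ m₁ m₂, Receives G act v m₁ → Receives G act v m₂ → m₁ = m₂ := by
    rintro m₁ m₂ ⟨_, u, hu, hs, ho⟩ ⟨_, u', hu', hs', _⟩
    by_cases h : u' = u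
    · subst h
      rw [hs] at hs'
      exact RadioAction.send.inj hs'
    · exact absurd hs' (ho u' hu' h m₂)
  unfold heard
  split_ifs with h
  · refine ⟨fun e => ?_, fun e => ?_⟩
    · rw [← Option.some.inj e]
      exact h.choose_spec
    · rw [uniq _ _ h.choose_spec e]
  · exact ⟨fun e => by simp at e, fun e => absurd ⟨m, e⟩ h⟩

section Execution

variable {V : Type*} {σ μ : Type}

/-- The local states of all nodes after `s` timesteps, when node `v` has ID `ident v` and draws the
number `x v s` in timestep `s` (timesteps are counted from `0`). -/
noncomputable def config (p : RadioProgram σ μ) (G : SimpleGraph V) (ident : V → ℕ)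
    (x : V → ℕ → ℝ) : ℕ → V → σ
  | 0 => fun v => p.start (ident v)
  | s + 1 => fun v =>
      p.receive (p.prepare (config p G ident x s v) (x v s))
        (heard G (fun u => p.action (p.prepare (config p G ident x s u) (x u s))) v)

/-- The action of node `v` in timestep `s`. -/
noncomputable def actionAt (p : RadioProgram σ μ) (G : SimpleGraph V) (ident : V → ℕ)
    (x : V → ℕ → ℝ) (s : ℕ) (v : V) : RadioAction μ :=
  p.action (p.prepare (config p G ident x s v) (x v s))

/-- The energy that node `v` uses in the first `T` timesteps. -/
noncomputable def energy (p : RadioProgram σ μ) (G : SimpleGraph V) (ident : V → ℕ)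
    (x : V → ℕ → ℝ) (T : ℕ) (v : V) : ℕ :=
  ∑ s ∈ Finset.range T, (actionAt p G ident x s v).cost

end Execution

namespace MatchingAlgorithm

/-- Messages: an ID, or an ordered pair of IDs. -/
inductive Message : Type
  | single (x : ℕ) : Message
  | pair (x y : ℕ) : Message

/-- Program counter: the beginning of a round, before the random choice; the three timesteps of the
recruit protocol, of the accept protocol, and of sleeping; termination. -/
inductive Control : Type
  | loop : Control
  | recruit₁ : Control
  | recruit₂ : Control
  | recruit₃ (x y : ℕ) : Control
  | accept₁ : Control
  | accept₂ (x : ℕ) : Control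
  | accept₃ : Control
  | sleep₁ : Control
  | sleep₂ : Control
  | sleep₃ : Control
  | halted : Control

structure NodeState : Type where
  myId : ℕ
  partner : Option ℕ
  round : ℕ
  control : Control

/-- `t_max`, as a real number. -/
noncomputable def tmax (C : ℝ) (n : ℕ) : ℝ := C * n * Real.log n

/-- The participation rate `r(t)`. -/
noncomputable def rate (C : ℝ) (n : ℕ) (t : ℕ) : ℝ :=
  3 * C * Real.log n / (4 * C * Real.log n + tmax C n - t)

open Classical in
/-- Start round `t` if `t ≤ t_max`, otherwise terminate. -/
noncomputable def enterRound (C : ℝ) (n : ℕ) (st : NodeState) (t : ℕ) : NodeState :=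
  { st with round := t, control := if (t : ℝ) ≤ tmax C n then .loop else .halted }

open Classical in
/-- At the beginning of a round, a node that already has a partner goes to sleep for the round; the
others choose between recruiting, accepting and sleeping according to `x`. -/
noncomputable def chooseRole (C : ℝ) (n : ℕ) (st : NodeState) (x : ℝ) : NodeState :=
  match st.control with
  | .loop =>
      { st with control :=
          if st.partner ≠ none then .sleep₁
          else if x ≤ rate C n st.round / 2 then .recruit₁
          else if x ≤ rate C n st.round then .accept₁
          else .sleep₁ }
  | _ => st

def act (st : NodeState) : RadioAction Message :=
  match st.control with
  | .recruit₁ => .send (.single st.myId)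
  | .recruit₂ => .listen
  | .recruit₃ x y => .send (.pair x y)
  | .accept₁ => .listen
  | .accept₂ x => .send (.pair x st.myId)
  | .accept₃ => .listen
  | _ => .sleep

/-- The local computation at the end of a timestep. -/
noncomputable def finish (C : ℝ) (n : ℕ) (st : NodeState) (m : Option Message) : NodeState :=
  match st.control with
  | .recruit₁ => { st with control := .recruit₂ }
  | .recruit₂ =>
      match m with
      | some (.pair x y) =>
          if x = st.myId then { st with partner := some y, control := .recruit₃ x y }
          else { st with control := .sleep₃ }
      | _ => { st with control := .sleep₃ }
  | .recruit₃ _ _ => enterRound C n st (st.round + 1)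
  | .accept₁ =>
      match m with
      | some (.single x) => { st with control := .accept₂ x }
      | _ => { st with control := .sleep₂ }
  | .accept₂ _ => { st with control := .accept₃ }
  | .accept₃ =>
      match m with
      | some (.pair x y) =>
          if y = st.myId then enterRound C n { st with partner := some x } (st.round + 1)
          else enterRound C n st (st.round + 1)
      | _ => enterRound C n st (st.round + 1)
  | .sleep₁ => { st with control := .sleep₂ }
  | .sleep₂ => { st with control := .sleep₃ }
  | .sleep₃ => enterRound C n st (st.round + 1)
  | .loop => st
  | .halted => st

/-- The maximal matching algorithm with constant `C`, for networks with `n` nodes. -/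
noncomputable def program (C : ℝ) (n : ℕ) : RadioProgram NodeState Message where
  start i := enterRound C n ⟨i, none, 1, .loop⟩ 1
  prepare := chooseRole C n
  action := act
  receive := finish C n

end MatchingAlgorithm

/-! Correctness is deterministic. A round acts on the partner function by `step`: an acceptor hears
a recruiter when exactly one free neighbour recruits, and the two pair up when no other acceptor
answers that recruiter. By `config_eq_snapshot`, three timesteps of the program perform one `step`;
by `partners_symm`, partners are always mutual, so every run ends with a matching.

For maximality let L = C log n and m = ⌊t_max⌋. With high probability, after t rounds every free
node has fewer than 1 + 2(m - t)/L free neighbours (`threshold`); at t = m this says that no two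
free nodes are adjacent. To see it, put k = m - t and look back over ⌊L⌋ + k rounds. If the bound
held at the start of this window, degrees stay O(1/r) throughout, so a free node with D free
neighbours pairs up with probability of order D r² in each round
(`IsRoleFamily.le_measureReal_weds`). Here r is of order L/(L + k) and D is at least 1 + 2k/L, so
this is of order L/(L + k), and the node survives the window with probability at most exp(-cL)
(`IsRoleFamily.measureReal_window_le`). The first violation of the bound must have such a window
before it, because for smaller t the threshold exceeds n - 1. A union bound over nodes and times
finishes (`IsRoleFamily.measureReal_crowded_end_le`).

For the energy, the rates form a harmonic sum of at most 3 L log n. Participation is independent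
across rounds, so a Chernoff bound applies, and a round costs at most 3. -/

namespace MatchingAlgorithm

/-- What a node without a partner does in a round. -/
inductive Role : Type
  | recruit : Role
  | accept : Role
  | rest : Role
  deriving DecidableEq

instance : Fintype Role := ⟨{.recruit, .accept, .rest}, by rintro (_ | _ | _) <;> decide⟩

/-! ### The round dynamics as a process on partner functions -/

section Rounds

variable {V : Type*} (G : SimpleGraph V)

/-- The acceptor `v` hears the recruiter `u` in the first timestep of a round, when `π` holds the
partners at the beginning of the round and `ρ` the roles drawn. -/
def Proposes (π : V → Option V) (ρ : V → Role) (v u : V) : Prop :=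
  G.Adj v u ∧ (π v = none ∧ ρ v = .accept) ∧ (π u = none ∧ ρ u = .recruit) ∧
    ∀ w, G.Adj v w → π w = none → ρ w = .recruit → w = u

/-- The recruiter `u` and the acceptor `v` become partners. -/
def Weds (π : V → Option V) (ρ : V → Role) (u v : V) : Prop :=
  Proposes G π ρ v u ∧ ∀ w, Proposes G π ρ w u → w = v

open Classical in
/-- The partners at the end of a round. -/
noncomputable def step (π : V → Option V) (ρ : V → Role) (v : V) : Option V :=
  if h : ∃ w, Weds G π ρ v w ∨ Weds G π ρ w v then some h.choose else π v

/-- The partners after `t` rounds, when node `v` draws the role `ρ s v` in the round with index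
`s`, rounds being counted from `0`. -/
noncomputable def partners (ρ : ℕ → V → Role) : ℕ → V → Option V
  | 0 => fun _ => none
  | t + 1 => step G (partners ρ t) (ρ t)

variable {G} {π : V → Option V} {ρ : V → Role} {u v w : V}

theorem Proposes.eq (h : Proposes G π ρ v u) (h' : Proposes G π ρ v w) : w = u :=
  h.2.2.2 w h'.1 h'.2.2.1.1 h'.2.2.1.2

theorem Weds.eq_right (h : Weds G π ρ u v) (h' : Weds G π ρ u w) : w = v := h.2 w h'.1

theorem Weds.eq_left (h : Weds G π ρ u v) (h' : Weds G π ρ w v) : w = u := h.1.eq h'.1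

theorem Weds.not_proposes (h : Weds G π ρ u v) : ¬ Proposes G π ρ u w := fun h' => by
  have h1 := h.1.2.2.1.2
  rw [h'.2.1.2] at h1
  exact absurd h1 (by decide)

/-- A node has one role per round, so it cannot wed both as recruiter and as acceptor; within one
role the spouse is unique. This makes the choice in `step` canonical. -/
theorem Weds.or_unique {w' : V} (h : Weds G π ρ v w ∨ Weds G π ρ w v)
    (h' : Weds G π ρ v w' ∨ Weds G π ρ w' v) : w' = w := by
  rcases h with h | h <;> rcases h' with h' | h'
  · exact h.eq_right h'
  · exact absurd h'.1 h.not_proposes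
  · exact absurd h.1 h'.not_proposes
  · exact h.eq_left h'

theorem Weds.or_none (h : Weds G π ρ v w ∨ Weds G π ρ w v) : π v = none := by
  rcases h with h | h
  · exact h.1.2.2.1.1
  · exact h.1.2.1.1

theorem step_of_weds (h : Weds G π ρ v w ∨ Weds G π ρ w v) : step G π ρ v = some w := by
  have h' : ∃ w, Weds G π ρ v w ∨ Weds G π ρ w v := ⟨w, h⟩
  rw [step, dif_pos h', Weds.or_unique h h'.choose_spec]

theorem step_of_not_weds (h : ∀ w, ¬ (Weds G π ρ v w ∨ Weds G π ρ w v)) :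
    step G π ρ v = π v := by
  rw [step, dif_neg (by simpa using h)]

theorem step_eq_some_iff :
    step G π ρ v = some w ↔ π v = some w ∨ Weds G π ρ v w ∨ Weds G π ρ w v := by
  by_cases h : ∃ w, Weds G π ρ v w ∨ Weds G π ρ w v
  · obtain ⟨u, hu⟩ := h
    rw [step_of_weds hu]
    constructor
    · intro e
      rw [← Option.some.inj e]
      exact Or.inr hu
    · rintro (e | e)
      · rw [Weds.or_none hu] at e
        simp at e
      · rw [Weds.or_unique hu e]
  · push Not at h
    have h' : ∀ w, ¬ (Weds G π ρ v w ∨ Weds G π ρ w v) := fun w => by simpa using h w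
    rw [step_of_not_weds h']
    have := h' w
    tauto

theorem step_none (h : step G π ρ v = none) : π v = none := by
  by_contra hπ
  obtain ⟨w, hw⟩ := Option.ne_none_iff_exists'.1 hπ
  rw [step_eq_some_iff.2 (Or.inl hw)] at h
  simp at h

/-- New pairs enter `step` symmetrically, and old ones persist because only free nodes wed. No
randomness is involved. -/
theorem partners_symm (ρ : ℕ → V → Role) (t : ℕ) :
    ∀ v w, partners G ρ t v = some w → G.Adj v w ∧ partners G ρ t w = some v := by
  induction t with
  | zero => intro v w h; simp [partners] at h
  | succ t ih =>
    intro v w h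
    rw [partners, step_eq_some_iff] at h
    rw [partners, step_eq_some_iff]
    rcases h with h | h | h
    · exact ⟨(ih v w h).1, Or.inl (ih v w h).2⟩
    · exact ⟨h.1.1.symm, Or.inr (Or.inr h)⟩
    · exact ⟨h.1.1, Or.inr (Or.inl h)⟩

/-- Causality: this is what makes the present round's roles independent of the current partners. -/
theorem partners_congr {ρ ρ' : ℕ → V → Role} {t : ℕ} (h : ∀ s < t, ρ s = ρ' s) :
    partners G ρ t = partners G ρ' t := by
  induction t with
  | zero => rfl
  | succ t ih =>
    rw [partners, partners, ih fun s hs => h s (by omega), h t (by omega)]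

theorem partners_none_of_le {ρ : ℕ → V → Role} {s t : ℕ} (hst : s ≤ t)
    (h : partners G ρ t v = none) : partners G ρ s v = none := by
  induction hst with
  | refl => exact h
  | step _ ih => exact ih (step_none h)

end Rounds

/-! ### Simulation of the program by the round dynamics -/

section Execution

variable {V : Type*} {G : SimpleGraph V} {ident : V → ℕ}

open Classical in
/-- The control of a node after its random choice, in the first timestep of a round. -/
noncomputable def control₁ (π : V → Option V) (ρ : V → Role) (v : V) : Control :=
  if π v = none then
    match ρ v with
    | .recruit => .recruit₁
    | .accept => .accept₁
    | .rest => .sleep₁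
  else .sleep₁

open Classical in
/-- The control of a node in the second timestep of a round. -/
noncomputable def control₂ (G : SimpleGraph V) (ident : V → ℕ) (π : V → Option V) (ρ : V → Role)
    (v : V) : Control :=
  if π v = none ∧ ρ v = .recruit then .recruit₂
  else if h : ∃ u, Proposes G π ρ v u then .accept₂ (ident h.choose)
  else .sleep₂

open Classical in
/-- The control of a node in the third timestep of a round. -/
noncomputable def control₃ (G : SimpleGraph V) (ident : V → ℕ) (π : V → Option V) (ρ : V → Role)
    (v : V) : Control :=
  if h : ∃ w, Weds G π ρ v w then .recruit₃ (ident v) (ident h.choose)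
  else if ∃ u, Proposes G π ρ v u then .accept₃
  else .sleep₃

open Classical in
/-- The partner of a node in the third timestep of a round, when only recruiters know the new
pairs. -/
noncomputable def recruited (G : SimpleGraph V) (π : V → Option V) (ρ : V → Role) (v : V) :
    Option V :=
  if h : ∃ w, Weds G π ρ v w then some h.choose else π v

variable {π : V → Option V} {ρ : V → Role} {u v w : V}

theorem control₁_recruit (h : π v = none ∧ ρ v = .recruit) : control₁ π ρ v = .recruit₁ := by
  simp [control₁, h.1, h.2]

theorem control₁_accept (h : π v = none ∧ ρ v = .accept) : control₁ π ρ v = .accept₁ := by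
  simp [control₁, h.1, h.2]

theorem control₁_rest (h : ¬ (π v = none ∧ ρ v = .recruit)) (h' : ¬ (π v = none ∧ ρ v = .accept)) :
    control₁ π ρ v = .sleep₁ := by
  rw [control₁]
  split_ifs with hπ
  · cases hρ : ρ v <;> simp_all
  · rfl

theorem control₂_recruit (h : π v = none ∧ ρ v = .recruit) :
    control₂ G ident π ρ v = .recruit₂ := if_pos h

theorem Proposes.not_recruit (h : Proposes G π ρ v u) : ¬ (π v = none ∧ ρ v = .recruit) := by
  rintro ⟨-, h'⟩
  rw [h.2.1.2] at h'
  exact absurd h' (by decide)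

theorem control₂_accept (h : Proposes G π ρ v u) :
    control₂ G ident π ρ v = .accept₂ (ident u) := by
  have h' : ∃ u, Proposes G π ρ v u := ⟨u, h⟩
  rw [control₂, if_neg h.not_recruit, dif_pos h', h.eq h'.choose_spec]

theorem control₂_sleep (h : ¬ (π v = none ∧ ρ v = .recruit)) (h' : ¬ ∃ u, Proposes G π ρ v u) :
    control₂ G ident π ρ v = .sleep₂ := by
  rw [control₂, if_neg h, dif_neg h']

theorem control₃_recruit (h : Weds G π ρ v w) :
    control₃ G ident π ρ v = .recruit₃ (ident v) (ident w) := by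
  have h' : ∃ w, Weds G π ρ v w := ⟨w, h⟩
  rw [control₃, dif_pos h', h.eq_right h'.choose_spec]

theorem control₃_accept (h : Proposes G π ρ v u) : control₃ G ident π ρ v = .accept₃ := by
  rw [control₃, dif_neg, if_pos ⟨u, h⟩]
  rintro ⟨w, hw⟩
  exact hw.not_proposes h

theorem control₃_sleep (h : ¬ ∃ w, Weds G π ρ v w) (h' : ¬ ∃ u, Proposes G π ρ v u) :
    control₃ G ident π ρ v = .sleep₃ := by
  rw [control₃, dif_neg h, if_neg h']

theorem recruited_of_weds (h : Weds G π ρ v w) : recruited G π ρ v = some w := by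
  have h' : ∃ w, Weds G π ρ v w := ⟨w, h⟩
  rw [recruited, dif_pos h', h.eq_right h'.choose_spec]

theorem recruited_of_not_weds (h : ¬ ∃ w, Weds G π ρ v w) : recruited G π ρ v = π v := by
  rw [recruited, dif_neg h]

theorem heard_eq_none {μ : Type} {act : V → RadioAction μ} (h : ∀ m, ¬ Receives G act v m) :
    heard G act v = none := by
  rw [heard, dif_neg (by simpa using h)]

/-- The first timestep of a round: acceptors may hear a recruiter. -/
theorem finish_control₁ (C : ℝ) (n r : ℕ) (v : V) :
    finish C n ⟨ident v, (π v).map ident, r, control₁ π ρ v⟩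
        (heard G (fun u => act ⟨ident u, (π u).map ident, r, control₁ π ρ u⟩) v) =
      ⟨ident v, (π v).map ident, r, control₂ G ident π ρ v⟩ := by
  by_cases hr : π v = none ∧ ρ v = .recruit
  · rw [control₁_recruit hr, control₂_recruit hr]
    rfl
  by_cases ha : π v = none ∧ ρ v = .accept
  · have send_iff : ∀ w m, act ⟨ident w, (π w).map ident, r, control₁ π ρ w⟩ = .send m ↔
        (π w = none ∧ ρ w = .recruit) ∧ m = .single (ident w) := by
      intro w m
      by_cases hw : π w = none ∧ ρ w = .recruit
      · rw [control₁_recruit hw]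
        simp [act, hw, eq_comm]
      · by_cases hw' : π w = none ∧ ρ w = .accept
        · rw [control₁_accept hw']
          simp [act, hw]
        · rw [control₁_rest hw hw']
          simp [act, hw]
    have receives_iff : ∀ m, Receives G
        (fun u => act ⟨ident u, (π u).map ident, r, control₁ π ρ u⟩) v m ↔
        ∃ u, Proposes G π ρ v u ∧ m = .single (ident u) := by
      intro m
      simp only [Receives, ne_eq, send_iff, Proposes]
      constructor
      · rintro ⟨-, u, h1, ⟨h2, h3⟩, h4⟩
        refine ⟨u, ⟨h1, ha, h2, fun w hw h5 h6 => ?_⟩, h3⟩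
        by_contra hne
        exact h4 w hw hne (.single (ident w)) ⟨⟨h5, h6⟩, rfl⟩
      · rintro ⟨u, ⟨h1, -, h2, h3⟩, h4⟩
        refine ⟨by rw [control₁_accept ha]; rfl, u, h1, ⟨h2, h4⟩, fun w hw hne m' h5 => ?_⟩
        exact hne (h3 w hw h5.1.1 h5.1.2)
    by_cases hp : ∃ u, Proposes G π ρ v u
    · obtain ⟨u, hu⟩ := hp
      rw [(heard_eq_some_iff _ _ _ _).2 ((receives_iff _).2 ⟨u, hu, rfl⟩), control₁_accept ha,
        control₂_accept hu]
      rfl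
    · rw [heard_eq_none, control₁_accept ha, control₂_sleep hr hp]
      · rfl
      · rintro m hm
        obtain ⟨u, hu, -⟩ := (receives_iff m).1 hm
        exact hp ⟨u, hu⟩
  · rw [control₁_rest hr ha, control₂_sleep hr]
    · rfl
    · rintro ⟨u, hu⟩
      exact ha hu.2.1

/-- The second timestep of a round: recruiters may hear an acceptor. -/
theorem finish_control₂ (C : ℝ) (n r : ℕ) (v : V) :
    finish C n ⟨ident v, (π v).map ident, r, control₂ G ident π ρ v⟩
        (heard G (fun u => act ⟨ident u, (π u).map ident, r, control₂ G ident π ρ u⟩) v) =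
      ⟨ident v, (recruited G π ρ v).map ident, r, control₃ G ident π ρ v⟩ := by
  by_cases hr : π v = none ∧ ρ v = .recruit
  · have send_iff : ∀ w m, act ⟨ident w, (π w).map ident, r, control₂ G ident π ρ w⟩ = .send m ↔
        ∃ u, Proposes G π ρ w u ∧ m = .pair (ident u) (ident w) := by
      intro w m
      by_cases hw : π w = none ∧ ρ w = .recruit
      · rw [control₂_recruit hw]
        simp only [act, reduceCtorEq, false_iff]
        rintro ⟨u, hu, -⟩
        exact hu.not_recruit hw
      · by_cases hp : ∃ u, Proposes G π ρ w u
        · obtain ⟨u, hu⟩ := hp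
          rw [control₂_accept hu]
          simp only [act, RadioAction.send.injEq]
          constructor
          · intro h
            exact ⟨u, hu, h.symm⟩
          · rintro ⟨u', hu', h⟩
            rw [h, hu.eq hu']
        · rw [control₂_sleep hw hp]
          simp only [act, reduceCtorEq, false_iff]
          rintro ⟨u, hu, -⟩
          exact hp ⟨u, hu⟩
    -- The recruiter `v` itself sends, so an adjacent acceptor that heard anything heard `v`. Every
    -- answer reaching `v` is therefore addressed to it, and reception fails only by collision or
    -- silence.
    have hpv : ∀ w u, G.Adj v w → Proposes G π ρ w u → u = v := fun w u hw hu =>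
      (hu.2.2.2 v hw.symm hr.1 hr.2).symm
    have receives_iff : ∀ m, Receives G
        (fun u => act ⟨ident u, (π u).map ident, r, control₂ G ident π ρ u⟩) v m ↔
        ∃ w, Weds G π ρ v w ∧ m = .pair (ident v) (ident w) := by
      intro m
      simp only [Receives, ne_eq, send_iff, Weds]
      constructor
      · rintro ⟨-, w, h1, ⟨u, h2, h3⟩, h4⟩
        obtain rfl := hpv w u h1 h2
        refine ⟨w, ⟨h2, fun w' hw' => ?_⟩, h3⟩
        by_contra hne
        exact h4 w' hw'.1.symm hne _ ⟨_, hw', rfl⟩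
      · rintro ⟨w, ⟨h1, h2⟩, h3⟩
        refine ⟨by rw [control₂_recruit hr]; rfl, w, h1.1.symm, ⟨v, h1, h3⟩, ?_⟩
        rintro w' hw' hne m' ⟨u, hu, -⟩
        obtain rfl := hpv w' u hw' hu
        exact hne (h2 w' hu)
    by_cases hp : ∃ u, Weds G π ρ v u
    · obtain ⟨u, hu⟩ := hp
      rw [(heard_eq_some_iff _ _ _ _).2 ((receives_iff _).2 ⟨u, hu, rfl⟩), control₂_recruit hr,
        control₃_recruit hu, recruited_of_weds hu]
      simp [finish]
    · rw [heard_eq_none, control₂_recruit hr, control₃_sleep hp, recruited_of_not_weds hp]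
      · rfl
      · rintro ⟨u, hu⟩
        exact hu.not_recruit hr
      · rintro m hm
        obtain ⟨u, hu, -⟩ := (receives_iff m).1 hm
        exact hp ⟨u, hu⟩
  · have hw : ¬ ∃ w, Weds G π ρ v w := by
      rintro ⟨w, hw⟩
      exact hr hw.1.2.2.1
    rw [recruited_of_not_weds hw]
    by_cases hp : ∃ u, Proposes G π ρ v u
    · obtain ⟨u, hu⟩ := hp
      rw [control₂_accept hu, control₃_accept hu]
      rfl
    · rw [control₂_sleep hr hp, control₃_sleep hw hp]
      rfl

/-- The third timestep of a round: acceptors may hear a confirmation. -/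
theorem finish_control₃ (hid : Function.Injective ident) (C : ℝ) (n r : ℕ) (v : V) :
    finish C n ⟨ident v, (recruited G π ρ v).map ident, r, control₃ G ident π ρ v⟩
        (heard G (fun u => act ⟨ident u, (recruited G π ρ u).map ident, r,
          control₃ G ident π ρ u⟩) v) =
      enterRound C n ⟨ident v, (step G π ρ v).map ident, r, .loop⟩ (r + 1) := by
  by_cases hw : ∃ w, Weds G π ρ v w
  · obtain ⟨w, hw⟩ := hw
    rw [control₃_recruit hw, recruited_of_weds hw, step_of_weds (Or.inl hw)]
    rfl
  rw [recruited_of_not_weds hw]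
  by_cases hp : ∃ u, Proposes G π ρ v u
  · obtain ⟨u, hu⟩ := hp
    have send_iff : ∀ w m, act ⟨ident w, (recruited G π ρ w).map ident, r,
        control₃ G ident π ρ w⟩ = .send m ↔
        ∃ w', Weds G π ρ w w' ∧ m = .pair (ident w) (ident w') := by
      intro w m
      by_cases hw : ∃ w', Weds G π ρ w w'
      · obtain ⟨w', hw⟩ := hw
        rw [control₃_recruit hw]
        simp only [act, RadioAction.send.injEq]
        constructor
        · intro h
          exact ⟨w', hw, h.symm⟩
        · rintro ⟨u', hu', h⟩
          rw [h, hw.eq_right hu']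
      · have : ¬ ∃ w', Weds G π ρ w w' ∧ m = .pair (ident w) (ident w') :=
          fun ⟨w', h, _⟩ => hw ⟨w', h⟩
        by_cases hp : ∃ u, Proposes G π ρ w u
        · obtain ⟨u, hu⟩ := hp
          rw [control₃_accept hu]
          simpa [act] using this
        · rw [control₃_sleep hw hp]
          simpa [act] using this
    have receives_iff : ∀ m, Receives G (fun u => act ⟨ident u, (recruited G π ρ u).map ident, r,
        control₃ G ident π ρ u⟩) v m ↔
        ∃ w, Weds G π ρ u w ∧ m = .pair (ident u) (ident w) := by
      intro m
      simp only [Receives, ne_eq, send_iff]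
      constructor
      · rintro ⟨-, u', h1, ⟨w, h2, h3⟩, h4⟩
        -- Only recruiters send now, and `u` is the only free recruiting neighbour of `v`, so a
        -- confirmation from `u` cannot collide.
        obtain rfl := hu.2.2.2 u' h1 h2.1.2.2.1.1 h2.1.2.2.1.2
        exact ⟨w, h2, h3⟩
      · rintro ⟨w, h1, h3⟩
        refine ⟨by rw [control₃_accept hu]; rfl, u, hu.1, ⟨w, h1, h3⟩, ?_⟩
        rintro u' hu' hne m' ⟨w', hw', -⟩
        exact hne (hu.2.2.2 u' hu' hw'.1.2.2.1.1 hw'.1.2.2.1.2)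
    rw [control₃_accept hu]
    have none_wed : ∀ w, Weds G π ρ u w → w ≠ v → step G π ρ v = π v := by
      intro w hw' hne
      refine step_of_not_weds fun u' hu' => ?_
      rcases hu' with hu' | hu'
      · exact hw ⟨u', hu'⟩
      · obtain rfl := hu.eq hu'.1
        exact hne (hu'.eq_right hw')
    by_cases hw' : ∃ w, Weds G π ρ u w
    · obtain ⟨w, hw'⟩ := hw'
      rw [(heard_eq_some_iff _ _ _ _).2 ((receives_iff _).2 ⟨w, hw', rfl⟩)]
      by_cases hwv : w = v
      · subst hwv
        rw [step_of_weds (Or.inr hw')]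
        simp [finish, enterRound]
      · rw [none_wed w hw' hwv]
        simp [finish, enterRound, hid.ne hwv]
    · rw [heard_eq_none, step_of_not_weds]
      · rfl
      · rintro u' (hu' | hu')
        · exact hw ⟨u', hu'⟩
        · obtain rfl := hu.eq hu'.1
          exact hw' ⟨v, hu'⟩
      · rintro m hm
        obtain ⟨w, hw'', -⟩ := (receives_iff m).1 hm
        exact hw' ⟨w, hw''⟩
  · rw [control₃_sleep hw hp, step_of_not_weds]
    · rfl
    · rintro u' (hu' | hu')
      · exact hw ⟨u', hu'⟩
      · exact hp ⟨u', hu'.1⟩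

open Classical in
/-- The role chosen in round `t` by a node without a partner that draws `x`. -/
noncomputable def roleOf (C : ℝ) (n t : ℕ) (x : ℝ) : Role :=
  if x ≤ rate C n t / 2 then .recruit else if x ≤ rate C n t then .accept else .rest

/-- The role drawn by each node in each round. -/
noncomputable def roles (C : ℝ) (n : ℕ) (x : V → ℕ → ℝ) (t : ℕ) (v : V) : Role :=
  roleOf C n (t + 1) (x v (3 * t))

theorem chooseRole_enterRound (C : ℝ) (n t : ℕ) (v : V) (x : ℝ) (c : Control) (r : ℕ)
    (ht : ((t + 1 : ℕ) : ℝ) ≤ tmax C n) (hx : ρ v = roleOf C n (t + 1) x) :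
    chooseRole C n (enterRound C n ⟨ident v, (π v).map ident, r, c⟩ (t + 1)) x =
      ⟨ident v, (π v).map ident, t + 1, control₁ π ρ v⟩ := by
  simp only [enterRound, if_pos ht, chooseRole, control₁, hx, roleOf]
  by_cases hπ : π v = none
  · simp only [hπ]
    split_ifs <;> simp_all
  · simp [hπ]

/-- Away from `.loop` the fresh random number is ignored, so only the draw in the first timestep of
a round matters. -/
theorem chooseRole_control₂ (C : ℝ) (n r : ℕ) (i : ℕ) (o : Option ℕ) (x : ℝ) (v : V) :
    chooseRole C n ⟨i, o, r, control₂ G ident π ρ v⟩ x = ⟨i, o, r, control₂ G ident π ρ v⟩ := by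
  rw [control₂]
  split_ifs <;> rfl

theorem chooseRole_control₃ (C : ℝ) (n r : ℕ) (i : ℕ) (o : Option ℕ) (x : ℝ) (v : V) :
    chooseRole C n ⟨i, o, r, control₃ G ident π ρ v⟩ x = ⟨i, o, r, control₃ G ident π ρ v⟩ := by
  rw [control₃]
  split_ifs <;> rfl

open Classical in
-- The bound depends on the drawn role alone, charging even nodes that sleep because they have a
-- partner. Energy is thereby dominated by a sum of independent indicators.
theorem cost_control₁ (i : ℕ) (o : Option ℕ) (r : ℕ) :
    (act ⟨i, o, r, control₁ π ρ v⟩).cost ≤ if ρ v = .rest then 0 else 1 := by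
  rw [control₁]
  split_ifs <;> cases hρ : ρ v <;> simp_all [act, RadioAction.cost]

open Classical in
theorem cost_control₂ (i : ℕ) (o : Option ℕ) (r : ℕ) :
    (act ⟨i, o, r, control₂ G ident π ρ v⟩).cost ≤ if ρ v = .rest then 0 else 1 := by
  by_cases hρ : ρ v = .rest
  · rw [if_pos hρ, control₂_sleep]
    · rfl
    · simp [hρ]
    · rintro ⟨u, hu⟩
      simp [hu.2.1.2] at hρ
  · rw [if_neg hρ]
    cases control₂ G ident π ρ v <;> simp [act, RadioAction.cost]

open Classical in
theorem cost_control₃ (i : ℕ) (o : Option ℕ) (r : ℕ) :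
    (act ⟨i, o, r, control₃ G ident π ρ v⟩).cost ≤ if ρ v = .rest then 0 else 1 := by
  by_cases hρ : ρ v = .rest
  · rw [if_pos hρ, control₃_sleep]
    · rfl
    · rintro ⟨u, hu⟩
      simp [hu.1.2.2.1.2] at hρ
    · rintro ⟨u, hu⟩
      simp [hu.2.1.2] at hρ
  · rw [if_neg hρ]
    cases control₃ G ident π ρ v <;> simp [act, RadioAction.cost]

section Run

variable (C : ℝ) (n : ℕ) (G) (ident) (x : V → ℕ → ℝ)

theorem config_succ (s : ℕ) (v : V) :
    config (program C n) G ident x (s + 1) v =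
      finish C n (chooseRole C n (config (program C n) G ident x s v) (x v s))
        (heard G (fun u => act (chooseRole C n (config (program C n) G ident x s u) (x u s))) v) :=
  rfl

/-- The nodes' states at the beginning of a round. -/
noncomputable def snapshot (ρ : ℕ → V → Role) (t : ℕ) (v : V) : NodeState :=
  enterRound C n ⟨ident v, (partners G ρ t v).map ident, t, .loop⟩ (t + 1)

variable {C n G ident x}

theorem config_round {t : ℕ} (ht : ((t + 1 : ℕ) : ℝ) ≤ tmax C n)
    (h : config (program C n) G ident x (3 * t) = snapshot G ident C n (roles C n x) t) :
    (∀ v, chooseRole C n (config (program C n) G ident x (3 * t) v) (x v (3 * t)) =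
      ⟨ident v, (partners G (roles C n x) t v).map ident, t + 1,
        control₁ (partners G (roles C n x) t) (roles C n x t) v⟩) ∧
    (∀ v y, chooseRole C n (config (program C n) G ident x (3 * t + 1) v) y =
      ⟨ident v, (partners G (roles C n x) t v).map ident, t + 1,
        control₂ G ident (partners G (roles C n x) t) (roles C n x t) v⟩) ∧
    (∀ v y, chooseRole C n (config (program C n) G ident x (3 * t + 2) v) y =
      ⟨ident v, (recruited G (partners G (roles C n x) t) (roles C n x t) v).map ident, t + 1,
        control₃ G ident (partners G (roles C n x) t) (roles C n x t) v⟩) := by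
  have h1 : ∀ v, chooseRole C n (config (program C n) G ident x (3 * t) v) (x v (3 * t)) =
      ⟨ident v, (partners G (roles C n x) t v).map ident, t + 1,
        control₁ (partners G (roles C n x) t) (roles C n x t) v⟩ := by
    intro v
    rw [h]
    exact chooseRole_enterRound (ρ := roles C n x t) C n t v _ _ _ ht rfl
  have h2 : ∀ v, config (program C n) G ident x (3 * t + 1) v =
      ⟨ident v, (partners G (roles C n x) t v).map ident, t + 1,
        control₂ G ident (partners G (roles C n x) t) (roles C n x t) v⟩ := by
    intro v
    simp only [config_succ, h1]
    exact finish_control₁ C n _ v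
  have h2' : ∀ v y, chooseRole C n (config (program C n) G ident x (3 * t + 1) v) y =
      ⟨ident v, (partners G (roles C n x) t v).map ident, t + 1,
        control₂ G ident (partners G (roles C n x) t) (roles C n x t) v⟩ := by
    intro v y
    rw [h2, chooseRole_control₂]
  refine ⟨h1, h2', fun v y => ?_⟩
  rw [config_succ G ident C n x (3 * t + 1)]
  simp only [h2']
  rw [finish_control₂, chooseRole_control₃]

/-- Induction over rounds: `config_round` follows the first two timesteps and `finish_control₃`
closes the round. Index `t` here is round `t + 1` of the program. -/
theorem config_eq_snapshot (hid : Function.Injective ident) {t : ℕ} (ht : (t : ℝ) ≤ tmax C n) :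
    config (program C n) G ident x (3 * t) = snapshot G ident C n (roles C n x) t := by
  induction t with
  | zero => rfl
  | succ t ih =>
    have ht' : (t : ℝ) ≤ tmax C n := le_trans (by push_cast; linarith) ht
    obtain ⟨-, -, h3⟩ := config_round ht (ih ht')
    funext v
    rw [show 3 * (t + 1) = 3 * t + 2 + 1 by ring, config_succ]
    simp only [h3]
    exact finish_control₃ hid C n _ v

theorem actionAt_eq (s : ℕ) (v : V) : actionAt (program C n) G ident x s v =
    act (chooseRole C n (config (program C n) G ident x s v) (x v s)) := rfl

open Classical in
theorem energy_le (hid : Function.Injective ident) (v : V) {t : ℕ} (ht : (t : ℝ) ≤ tmax C n) :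
    energy (program C n) G ident x (3 * t) v ≤
      3 * ∑ s ∈ Finset.range t, if roles C n x s v = .rest then 0 else 1 := by
  induction t with
  | zero => simp [energy]
  | succ t ih =>
    have ht' : (t : ℝ) ≤ tmax C n := le_trans (by push_cast; linarith) ht
    obtain ⟨h1, h2, h3⟩ := config_round ht (config_eq_snapshot (G := G) (x := x) hid ht')
    have ih := ih ht'
    rw [energy] at ih
    rw [energy, show 3 * (t + 1) = 3 * t + 2 + 1 by ring, Finset.sum_range_succ,
      Finset.sum_range_succ, Finset.sum_range_succ, Finset.sum_range_succ, actionAt_eq, actionAt_eq,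
      actionAt_eq, h1, h2, h3]
    have e1 := cost_control₁ (π := partners G (roles C n x) t) (ρ := roles C n x t) (v := v)
      (ident v) ((partners G (roles C n x) t v).map ident) (t + 1)
    have e2 := cost_control₂ (G := G) (ident := ident) (π := partners G (roles C n x) t)
      (ρ := roles C n x t) (v := v)
      (ident v) ((partners G (roles C n x) t v).map ident) (t + 1)
    have e3 := cost_control₃ (G := G) (ident := ident) (π := partners G (roles C n x) t)
      (ρ := roles C n x t) (v := v) (ident v)
      ((recruited G (partners G (roles C n x) t) (roles C n x t) v).map ident) (t + 1)
    omega

theorem config_final (hid : Function.Injective ident) (hC : 0 ≤ tmax C n) {s : ℕ}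
    (hs : 3 * ⌊tmax C n⌋₊ ≤ s) (v : V) :
    config (program C n) G ident x s v = ⟨ident v,
      (partners G (roles C n x) ⌊tmax C n⌋₊ v).map ident, ⌊tmax C n⌋₊ + 1, .halted⟩ := by
  induction s, hs using Nat.le_induction generalizing v with
  | base =>
    rw [config_eq_snapshot hid (Nat.floor_le hC), snapshot, enterRound, if_neg]
    rw [not_le]
    push_cast
    exact Nat.lt_floor_add_one (tmax C n)
  | succ s _ ih =>
    rw [config_succ, ih]
    rfl

end Run

/-! ### Mutual partners as a maximal matching -/

/-- The matching formed by mutual partners. -/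
def matching (G : SimpleGraph V) (π : V → Option V) : G.Subgraph where
  verts := {v | ∃ w, G.Adj v w ∧ π v = some w ∧ π w = some v}
  Adj v w := G.Adj v w ∧ π v = some w ∧ π w = some v
  adj_sub h := h.1
  edge_vert h := ⟨_, h⟩
  symm := ⟨fun _ _ h => ⟨h.1.symm, h.2.2, h.2.1⟩⟩

theorem matching_isMatching (G : SimpleGraph V) (π : V → Option V) : (matching G π).IsMatching := by
  rintro v ⟨w, hw⟩
  refine ⟨w, hw, fun w' hw' => ?_⟩
  have := hw'.2.1
  rw [hw.2.1] at this
  exact (Option.some.inj this).symm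

theorem matching_adj_iff (hπ : ∀ v w, π v = some w → G.Adj v w ∧ π w = some v) :
    (matching G π).Adj v w ↔ π v = some w :=
  ⟨fun h => h.2.1, fun h => ⟨(hπ v w h).1, h, (hπ v w h).2⟩⟩

theorem mem_verts_matching_iff (hπ : ∀ v w, π v = some w → G.Adj v w ∧ π w = some v) :
    v ∈ (matching G π).verts ↔ π v ≠ none := by
  rw [Option.ne_none_iff_exists']
  exact exists_congr fun w => matching_adj_iff hπ

/-- An edge of a larger matching `N` has an end that already has a partner. The edge to that partner
also lies in `N`, and `N` has only one edge there, so the two coincide. -/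
theorem matching_maximal (hπ : ∀ v w, π v = some w → G.Adj v w ∧ π w = some v)
    (h : ∀ v w, G.Adj v w → π v = none → π w ≠ none) :
    Maximal (fun N : G.Subgraph => N.IsMatching) (matching G π) := by
  refine ⟨matching_isMatching G π, fun N hN hle => ?_⟩
  have adj_of : ∀ v w, N.Adj v w → π v ≠ none → (matching G π).Adj v w := by
    intro v w hvw hv
    obtain ⟨w', hw'⟩ := Option.ne_none_iff_exists'.1 hv
    have h' := (matching_adj_iff hπ).2 hw'
    rw [hN.eq_of_adj_left hvw (hle.2 h')]
    exact h'
  have hadj : ∀ v w, N.Adj v w → (matching G π).Adj v w := by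
    intro v w hvw
    by_cases hv : π v = none
    · exact (adj_of w v hvw.symm (h v w hvw.adj_sub hv)).symm
    · exact adj_of v w hvw hv
  refine ⟨fun v hv => ?_, fun v w => hadj v w⟩
  obtain ⟨w, hw, -⟩ := hN hv
  exact (hadj v w hw).fst_mem

end Execution

end MatchingAlgorithm

/-! ### Conditioning on an independent past -/

/-- If `Z` avoids `B a` with probability at most `q`, for each value `a ∈ A` of an independent
variable `Y`, then the event that `Y ∈ A` and `Z` avoids `B Y` has probability at most
`q * P (Y ∈ A)`. -/
theorem ProbabilityTheory.IndepFun.measureReal_mem_notMem_le {Ω α β : Type*} [MeasurableSpace Ω]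
    {P : Measure Ω} [IsFiniteMeasure P] [Finite α] [MeasurableSpace α] [DiscreteMeasurableSpace α]
    [MeasurableSpace β] [DiscreteMeasurableSpace β] {Y : Ω → α} {Z : Ω → β} (h : IndepFun Y Z P)
    (hY : Measurable Y) (A : Set α) (B : α → Set β) {q : ℝ}
    (hB : ∀ a ∈ A, P.real {ω | Z ω ∉ B a} ≤ q) :
    P.real {ω | Y ω ∈ A ∧ Z ω ∉ B (Y ω)} ≤ q * P.real {ω | Y ω ∈ A} := by
  classical
  have := Fintype.ofFinite α
  have hsub : {ω | Y ω ∈ A ∧ Z ω ∉ B (Y ω)} ⊆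
      ⋃ a ∈ A.toFinset, (Y ⁻¹' {a} ∩ Z ⁻¹' (B a)ᶜ) := by
    rintro ω ⟨h1, h2⟩
    simp only [Set.mem_iUnion]
    exact ⟨Y ω, by simpa using h1, rfl, h2⟩
  calc P.real {ω | Y ω ∈ A ∧ Z ω ∉ B (Y ω)}
      ≤ P.real (⋃ a ∈ A.toFinset, (Y ⁻¹' {a} ∩ Z ⁻¹' (B a)ᶜ)) := measureReal_mono hsub (measure_ne_top _ _)
    _ ≤ ∑ a ∈ A.toFinset, P.real (Y ⁻¹' {a} ∩ Z ⁻¹' (B a)ᶜ) := measureReal_biUnion_finset_le _ _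
    _ ≤ ∑ a ∈ A.toFinset, q * P.real (Y ⁻¹' {a}) := by
        refine Finset.sum_le_sum fun a ha => ?_
        rw [measureReal_def, h.measure_inter_preimage_eq_mul _ _ (.of_discrete) (.of_discrete),
          ENNReal.toReal_mul, mul_comm]
        exact mul_le_mul_of_nonneg_right (hB a (by simpa using ha)) ENNReal.toReal_nonneg
    _ = q * P.real {ω | Y ω ∈ A} := by
        rw [← Finset.mul_sum, sum_measureReal_preimage_singleton]
        · congr 2
          ext ω
          simp
        · exact fun a _ => hY .of_discrete

namespace MatchingAlgorithm

instance : MeasurableSpace Role := ⊤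

instance : DiscreteMeasurableSpace Role := ⟨fun _ => trivial⟩

/-! ### Free neighbours and undisturbed meetings -/

section Degrees

variable {V : Type*} [Fintype V]

open Classical in
/-- The neighbours without a partner. -/
noncomputable def freeNeighbors (G : SimpleGraph V) (π : V → Option V) (v : V) : Finset V :=
  Finset.univ.filter fun u => G.Adj v u ∧ π u = none

variable {G : SimpleGraph V} {π : V → Option V} {u v w : V}

theorem mem_freeNeighbors : u ∈ freeNeighbors G π v ↔ G.Adj v u ∧ π u = none := by
  simp [freeNeighbors]

theorem freeNeighbors_antitone (ρ : ℕ → V → Role) {s t : ℕ} (hst : s ≤ t) (v : V) :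
    freeNeighbors G (partners G ρ t) v ⊆ freeNeighbors G (partners G ρ s) v := by
  intro u hu
  rw [mem_freeNeighbors] at *
  exact ⟨hu.1, partners_none_of_le hst hu.2⟩

open Classical in
/-- The free nodes that must rest for `u` and `v` to meet undisturbed. -/
noncomputable def disturbers (G : SimpleGraph V) (π : V → Option V) (u v : V) : Finset V :=
  ((freeNeighbors G π u ∪ freeNeighbors G π v).erase u).erase v

theorem mem_disturbers : w ∈ disturbers G π u v ↔
    w ≠ v ∧ w ≠ u ∧ (G.Adj u w ∨ G.Adj v w) ∧ π w = none := by
  simp only [disturbers, Finset.mem_erase, Finset.mem_union, mem_freeNeighbors]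
  tauto

theorem card_disturbers_le : (disturbers G π u v).card ≤
    (freeNeighbors G π u).card + (freeNeighbors G π v).card := by
  classical
  exact (Finset.card_erase_le.trans Finset.card_erase_le).trans (Finset.card_union_le _ _)

/-- Resting neighbours of `v` let `v` hear `u`; resting neighbours of `u` leave `v` as the only one
to answer. -/
theorem weds_of_undisturbed {ρ : V → Role} (huv : G.Adj v u) (hv : π v = none) (hu : π u = none)
    (hρu : ρ u = .recruit) (hρv : ρ v = .accept) (h : ∀ w ∈ disturbers G π u v, ρ w = .rest) :
    Weds G π ρ u v := by
  refine ⟨⟨huv, ⟨hv, hρv⟩, ⟨hu, hρu⟩, fun w hw h1 h2 => ?_⟩, fun w hw => ?_⟩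
  · by_contra hne
    have := h w (mem_disturbers.2 ⟨hw.ne', hne, Or.inr hw, h1⟩)
    simp [h2] at this
  · by_contra hne
    have := h w (mem_disturbers.2 ⟨hne, hw.1.ne, Or.inl hw.1.symm, hw.2.1.1⟩)
    simp [hw.2.1.2] at this

end Degrees

/-- By convexity of exp it suffices that (1 - r)(1 + 4r) ≥ 1, which for r ≥ 0 holds exactly up to r
= 3/4, the largest rate allowed by the term 4L in its denominator. -/
theorem exp_neg_le_one_sub_pow {r : ℝ} (hr : r ≤ 3 / 4) (h0 : 0 ≤ r) (k : ℕ) :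
    Real.exp (-(4 * r * k)) ≤ (1 - r) ^ k := by
  have h1 : 0 < 1 - r := by linarith
  have h2 : Real.exp (-(4 * r)) ≤ 1 - r := by
    rw [Real.exp_neg, inv_le_comm₀ (Real.exp_pos _) h1]
    have h3 : (1 - r)⁻¹ ≤ 4 * r + 1 := by
      rw [inv_le_iff_one_le_mul₀ h1]
      nlinarith
    exact h3.trans (Real.add_one_le_exp _)
  calc Real.exp (-(4 * r * k)) = Real.exp (-(4 * r)) ^ k := by
        rw [← Real.exp_nat_mul]
        ring_nf
    _ ≤ (1 - r) ^ k := pow_le_pow_left₀ (Real.exp_pos _).le h2 k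

/-! ### Probability estimates for one round, for a window, and for participation -/

section Random

variable {V : Type*} {G : SimpleGraph V} {Ω : Type*} [MeasurableSpace Ω]
  {P : Measure Ω} {R : V × ℕ → Ω → Role} {r : ℕ → ℝ}

/-- `R` is a family of independent random roles, and a node participates in round `t` with
probability `r t`, being equally likely to recruit and to accept. -/
structure IsRoleFamily (R : V × ℕ → Ω → Role) (P : Measure Ω) (r : ℕ → ℝ) (m : ℕ) : Prop where
  measurable : ∀ i, Measurable (R i)
  indep : iIndepFun R P
  recruit : ∀ v, ∀ t < m, P.real (R (v, t) ⁻¹' {.recruit}) = r t / 2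
  accept : ∀ v, ∀ t < m, P.real (R (v, t) ⁻¹' {.accept}) = r t / 2
  rest : ∀ v, ∀ t < m, P.real (R (v, t) ⁻¹' {.rest}) = 1 - r t

/-- The history of roles. -/
def history (R : V × ℕ → Ω → Role) (ω : Ω) (t : ℕ) (v : V) : Role := R (v, t) ω

variable {m : ℕ}

/-- Conditioning on the first `t` rounds: `E` and the partners are functions of them, and the roles
of round `t` are independent of them. -/
theorem IsRoleFamily.measureReal_past_le [Fintype V] [IsProbabilityMeasure P] (h : IsRoleFamily R P r m) (t : ℕ)
    {E : Set (ℕ → V → Role)}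
    (hE : ∀ ρ ρ' : ℕ → V → Role, (∀ s < t, ρ s = ρ' s) → ρ ∈ E → ρ' ∈ E)
    (B : (V → Option V) → Set (V → Role)) {q : ℝ}
    (hB : ∀ ρ ∈ E, P.real {ω | history R ω t ∉ B (partners G ρ t)} ≤ q) :
    P.real {ω | history R ω ∈ E ∧ history R ω t ∉ B (partners G (history R ω) t)} ≤
      q * P.real {ω | history R ω ∈ E} := by
  classical
  let S : Finset (V × ℕ) := Finset.univ ×ˢ Finset.range t
  let S' : Finset (V × ℕ) := Finset.univ ×ˢ {t}
  have hdisj : Disjoint S S' := by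
    rw [Finset.disjoint_left]
    rintro ⟨v, s⟩ h1 h2
    simp only [S, S', Finset.mem_product, Finset.mem_range, Finset.mem_singleton] at h1 h2
    omega
  have hind := h.indep.indepFun_finset S S' hdisj h.measurable
  -- The filler `.rest` is harmless: neither `E` nor the partners after `t` rounds depend on roles
  -- from index `t` on.
  let past : (S → Role) → ℕ → V → Role := fun g s v =>
    if hs : (v, s) ∈ S then g ⟨(v, s), hs⟩ else .rest
  let present : (S' → Role) → V → Role := fun g v => g ⟨(v, t), by simp [S']⟩
  have hY : Measurable (fun ω (i : S) => R i ω) := measurable_pi_lambda _ fun i => h.measurable i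
  have hind' : IndepFun (fun ω (i : S) => R i ω) (fun ω => history R ω t) P :=
    hind.comp (φ := id) (ψ := present) measurable_id (Measurable.of_discrete)
  have hpast : ∀ ω, ∀ s < t, past (fun i : S => R i ω) s = history R ω s := by
    intro ω s hs
    funext v
    have : (v, s) ∈ S := by simp [S, hs]
    simp [past, this, history]
  have hpart : ∀ ω, partners G (past (fun i : S => R i ω)) t = partners G (history R ω) t :=
    fun ω => partners_congr (hpast ω)
  have hmem : ∀ ω, past (fun i : S => R i ω) ∈ E ↔ history R ω ∈ E := fun ω =>
    ⟨hE _ _ (hpast ω), hE _ _ fun s hs => (hpast ω s hs).symm⟩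
  have key := hind'.measureReal_mem_notMem_le hY {g | past g ∈ E}
    (fun g => B (partners G (past g) t)) (q := q) (fun g hg => hB _ hg)
  simpa only [Set.mem_ofPred_eq, hmem, hpart] using key

theorem IsRoleFamily.measureReal_undisturbed [Fintype V] (h : IsRoleFamily R P r m) {t : ℕ} (ht : t < m)
    (π : V → Option V) {u v : V} (huv : u ≠ v) :
    P.real {ω | R (u, t) ω = .recruit ∧ R (v, t) ω = .accept ∧
      ∀ w ∈ disturbers G π u v, R (w, t) ω = .rest} =
      (r t / 2) ^ 2 * (1 - r t) ^ (disturbers G π u v).card := by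
  classical
  let c : V → Set Role := fun w =>
    if w = u then {.recruit} else if w = v then {.accept} else {.rest}
  have hu : u ∉ insert v (disturbers G π u v) := by
    rw [Finset.mem_insert, mem_disturbers]
    tauto
  have hv : v ∉ disturbers G π u v := by
    rw [mem_disturbers]
    tauto
  have hind : iIndepFun (fun w => R (w, t)) P :=
    h.indep.precomp (g := fun w : V => (w, t)) fun a b hab => (Prod.mk.inj hab).1
  have key := hind.measure_inter_preimage_eq_mul (insert u (insert v (disturbers G π u v)))
    (sets := c) fun i _ => .of_discrete
  have hc : ∀ w ∈ disturbers G π u v, c w = {.rest} := by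
    intro w hw
    rw [mem_disturbers] at hw
    simp [c, hw.1, hw.2.1]
  have hset : {ω | R (u, t) ω = .recruit ∧ R (v, t) ω = .accept ∧
      ∀ w ∈ disturbers G π u v, R (w, t) ω = .rest} =
      ⋂ i ∈ insert u (insert v (disturbers G π u v)), R (i, t) ⁻¹' c i := by
    ext ω
    simp only [Set.mem_ofPred_eq, Set.mem_iInter, Finset.forall_mem_insert, Set.mem_preimage]
    refine and_congr (by simp [c]) (and_congr (by simp [c, huv.symm]) ?_)
    refine forall₂_congr fun w hw => ?_
    rw [hc w hw]
    rfl
  rw [hset, measureReal_def, key, Finset.prod_insert hu, Finset.prod_insert hv,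
    ENNReal.toReal_mul, ENNReal.toReal_mul, ENNReal.toReal_prod, pow_two, mul_assoc]
  simp only [← measureReal_def]
  congr 1
  · rw [← h.recruit u t ht]
    simp [c]
  congr 1
  · rw [← h.accept v t ht]
    simp [c, huv.symm]
  · rw [Finset.prod_congr rfl fun w hw => by rw [hc w hw, h.rest w t ht], Finset.prod_const]

/-- A free node with at least `D` free neighbours finds a partner with probability of order
`D * r ^ 2`, when the degrees are at most of order `1 / r`. -/
theorem IsRoleFamily.le_measureReal_weds [Fintype V] [IsProbabilityMeasure P] (h : IsRoleFamily R P r m) {t : ℕ} (ht : t < m)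
    (hr : r t ≤ 3 / 4) (h0 : 0 ≤ r t) {π : V → Option V} {D Δ : ℝ}
    (hΔ : ∀ w, π w = none → ((freeNeighbors G π w).card : ℝ) ≤ Δ) {v : V} (hv : π v = none)
    (hD : D ≤ (freeNeighbors G π v).card) :
    D * ((r t / 2) ^ 2 * Real.exp (-(8 * r t * Δ))) ≤
      P.real {ω | ∃ u, Weds G π (history R ω t) u v} := by
  classical
  let E : V → Set Ω := fun u => {ω | R (u, t) ω = .recruit ∧ R (v, t) ω = .accept ∧
      ∀ w ∈ disturbers G π u v, R (w, t) ω = .rest}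
  have hE : ∀ u ∈ freeNeighbors G π v,
      (r t / 2) ^ 2 * Real.exp (-(8 * r t * Δ)) ≤ P.real (E u) := by
    intro u hu
    rw [mem_freeNeighbors] at hu
    rw [h.measureReal_undisturbed ht π hu.1.ne']
    refine mul_le_mul_of_nonneg_left ?_ (sq_nonneg _)
    -- There are at most 2Δ disturbers, which turns the constant 4 of that lemma into 8.
    refine le_trans ?_ (exp_neg_le_one_sub_pow hr h0 _)
    rw [Real.exp_le_exp, neg_le_neg_iff]
    have h1 : ((disturbers G π u v).card : ℝ) ≤
        (freeNeighbors G π u).card + (freeNeighbors G π v).card := by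
      exact_mod_cast card_disturbers_le
    have h2 := hΔ u hu.2
    have h3 := hΔ v hv
    nlinarith
  have hsub : (⋃ u ∈ freeNeighbors G π v, E u) ⊆ {ω | ∃ u, Weds G π (history R ω t) u v} := by
    intro ω hω
    simp only [Set.mem_iUnion] at hω
    obtain ⟨u, hu, h1, h2, h3⟩ := hω
    rw [mem_freeNeighbors] at hu
    exact ⟨u, weds_of_undisturbed hu.1 hv hu.2 h1 h2 h3⟩
  -- If two neighbours of `v` recruited, each would disturb the meeting of `v` with the other.
  have hdisj : (↑(freeNeighbors G π v) : Set V).PairwiseDisjoint E := by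
    intro u hu u' hu' hne
    rw [Function.onFun, Set.disjoint_left]
    rintro ω ⟨-, -, h1⟩ ⟨h2, -, -⟩
    rw [Finset.mem_coe, mem_freeNeighbors] at hu'
    have := h1 u' (mem_disturbers.2 ⟨hu'.1.ne', hne.symm, Or.inr hu'.1, hu'.2⟩)
    simp [h2] at this
  have hmeas : ∀ u, MeasurableSet (E u) := by
    intro u
    have e : E u = R (u, t) ⁻¹' {.recruit} ∩ (R (v, t) ⁻¹' {.accept} ∩
        ⋂ w ∈ disturbers G π u v, R (w, t) ⁻¹' {.rest}) := by
      ext ω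
      simp [E]
    rw [e]
    exact (h.measurable _ .of_discrete).inter ((h.measurable _ .of_discrete).inter
      (Finset.measurableSet_biInter _ fun w _ => h.measurable _ .of_discrete))
  calc D * ((r t / 2) ^ 2 * Real.exp (-(8 * r t * Δ)))
      ≤ (freeNeighbors G π v).card * ((r t / 2) ^ 2 * Real.exp (-(8 * r t * Δ))) :=
        mul_le_mul_of_nonneg_right hD (by positivity)
    _ = ∑ u ∈ freeNeighbors G π v, (r t / 2) ^ 2 * Real.exp (-(8 * r t * Δ)) := by
        rw [Finset.sum_const, nsmul_eq_mul]
    _ ≤ ∑ u ∈ freeNeighbors G π v, P.real (E u) := Finset.sum_le_sum hE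
    _ = P.real (⋃ u ∈ freeNeighbors G π v, E u) :=
        (measureReal_biUnion_finset hdisj fun u _ => hmeas u).symm
    _ ≤ _ := measureReal_mono hsub

/-- The node `v` has no partner, and at least `D` free neighbours. -/
def Crowded [Fintype V] (G : SimpleGraph V) (π : V → Option V) (D : ℝ) (v : V) : Prop :=
  π v = none ∧ D ≤ (freeNeighbors G π v).card

theorem Crowded.of_le [Fintype V] {ρ : ℕ → V → Role} {s t : ℕ} {D : ℝ} {v : V} (hst : s ≤ t)
    (h : Crowded G (partners G ρ t) D v) : Crowded G (partners G ρ s) D v :=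
  ⟨partners_none_of_le hst h.1, h.2.trans (by
    exact_mod_cast Finset.card_le_card (freeNeighbors_antitone ρ hst v))⟩

/-- After degrees have been at most `Δ`, a node is unlikely to stay crowded for long. -/
theorem IsRoleFamily.measureReal_crowded_le [Fintype V] [IsProbabilityMeasure P] (h : IsRoleFamily R P r m) {t₀ s : ℕ}
    (hs : t₀ + s ≤ m) {D Δ p : ℝ} (hp : p ≤ 1)
    (hr : ∀ t, t₀ ≤ t → t < t₀ + s → 0 ≤ r t ∧ r t ≤ 3 / 4 ∧
      p ≤ D * ((r t / 2) ^ 2 * Real.exp (-(8 * r t * Δ)))) (v : V) :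
    P.real {ω | (∀ w, ¬ Crowded G (partners G (history R ω) t₀) Δ w) ∧
      Crowded G (partners G (history R ω) (t₀ + s)) D v} ≤ Real.exp (-(s * p)) := by
  -- Each round of the window contributes a factor 1 - p, conditionally on the rounds before it.
  suffices H : P.real {ω | (∀ w, ¬ Crowded G (partners G (history R ω) t₀) Δ w) ∧
      Crowded G (partners G (history R ω) (t₀ + s)) D v} ≤ (1 - p) ^ s by
    refine H.trans ?_
    rw [← mul_neg, Real.exp_nat_mul]
    exact pow_le_pow_left₀ (by linarith) (Real.one_sub_le_exp_neg p) s
  induction s with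
  | zero => simp
  | succ s ih =>
    have ih := ih (by omega) fun t h1 h2 => hr t h1 (by omega)
    obtain ⟨hr0, hr1, hpr⟩ := hr (t₀ + s) (by omega) (by omega)
    let E : Set (ℕ → V → Role) := {ρ | (∀ w, ¬ Crowded G (partners G ρ t₀) Δ w) ∧
      Crowded G (partners G ρ (t₀ + s)) D v}
    have hE : ∀ ρ ρ' : ℕ → V → Role, (∀ s' < t₀ + s, ρ s' = ρ' s') → ρ ∈ E → ρ' ∈ E := by
      rintro ρ ρ' hρ ⟨h1, h2⟩
      refine ⟨?_, ?_⟩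
      · rwa [← partners_congr fun s' hs' => hρ s' (by omega)]
      · rwa [← partners_congr hρ]
    have key := h.measureReal_past_le (G := G) (t₀ + s) hE
      (fun π => {ρ | ∃ u, Weds G π ρ u v}) (q := 1 - p) ?_
    · refine (measureReal_mono ?_).trans (key.trans ?_)
      · rintro ω ⟨h1, h2⟩
        refine ⟨⟨h1, h2.of_le (by omega)⟩, ?_⟩
        rintro ⟨u, hu⟩
        have h3 := h2.1
        rw [← add_assoc, partners, step_of_weds (Or.inr hu)] at h3
        simp at h3
      · rw [pow_succ']
        exact mul_le_mul_of_nonneg_left ih (by linarith)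
    · rintro ρ ⟨h1, h2⟩
      -- Free degrees only decrease, so the bound at `t₀` persists through the window.
      have hΔ : ∀ w, partners G ρ (t₀ + s) w = none →
          ((freeNeighbors G (partners G ρ (t₀ + s)) w).card : ℝ) ≤ Δ := by
        intro w hw
        by_contra hlt
        have : Crowded G (partners G ρ (t₀ + s)) Δ w := ⟨hw, (not_le.1 hlt).le⟩
        exact h1 w (this.of_le (by omega))
      have hw := h.le_measureReal_weds (by omega : t₀ + s < m) hr1 hr0 hΔ h2.1 h2.2
      have hmeas : MeasurableSet
          {ω | ∃ u, Weds G (partners G ρ (t₀ + s)) (history R ω (t₀ + s)) u v} := by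
        have hZ : Measurable fun ω => history R ω (t₀ + s) :=
          measurable_pi_lambda _ fun v => h.measurable _
        exact hZ (MeasurableSet.of_discrete
          (s := {g | ∃ u, Weds G (partners G ρ (t₀ + s)) g u v}))
      have hcompl := probReal_compl_eq_one_sub (μ := P) hmeas
      change P.real {ω | ∃ u, Weds G (partners G ρ (t₀ + s)) (history R ω (t₀ + s)) u v}ᶜ ≤ _
      rw [hcompl]
      linarith

open Classical in
/-- Chernoff bound for the number of rounds in which a node participates. -/
theorem IsRoleFamily.measureReal_participation_le [IsProbabilityMeasure P] (h : IsRoleFamily R P r m) (v : V) (a : ℝ) :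
    P.real {ω | a ≤ ∑ t ∈ Finset.range m, if R (v, t) ω = .rest then (0 : ℝ) else 1} ≤
      Real.exp ((Real.exp 1 - 1) * (∑ t ∈ Finset.range m, r t) - a) := by
  let Y : ℕ → Ω → ℝ := fun t ω => if R (v, t) ω = .rest then 0 else 1
  have hmeas : ∀ t, Measurable (Y t) := fun t =>
    (Measurable.of_discrete (f := fun x : Role => if x = .rest then (0 : ℝ) else 1)).comp
      (h.measurable (v, t))
  have hind : iIndepFun Y P := by
    have h1 : iIndepFun (fun t => R (v, t)) P :=
      h.indep.precomp (g := fun t : ℕ => (v, t)) fun a b hab => (Prod.mk.inj hab).2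
    exact h1.comp (fun _ x => if x = .rest then (0 : ℝ) else 1) fun _ => .of_discrete
  -- The indicator has E exp(Y) = 1 + (e - 1) r, and 1 + x ≤ exp x.
  have hmgf : ∀ t < m, mgf (Y t) P 1 ≤ Real.exp ((Real.exp 1 - 1) * r t) := by
    intro t ht
    have hset : MeasurableSet (R (v, t) ⁻¹' {.rest}) := h.measurable _ .of_discrete
    have e : (fun ω => Real.exp (1 * Y t ω)) = fun ω =>
        Real.exp 1 - (R (v, t) ⁻¹' {.rest}).indicator (fun _ => Real.exp 1 - 1) ω := by
      funext ω
      by_cases hω : R (v, t) ω = .rest <;> simp [Y, hω, Set.indicator]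
    rw [mgf, e, integral_sub (integrable_const _) ((integrable_const _).indicator hset),
      integral_indicator_const _ hset, h.rest v t ht]
    have := Real.add_one_le_exp ((Real.exp 1 - 1) * r t)
    simp only [integral_const, probReal_univ, smul_eq_mul]
    linarith
  have hsum : (fun ω => ∑ t ∈ Finset.range m, Y t ω) = ∑ t ∈ Finset.range m, Y t := by
    funext ω
    rw [Finset.sum_apply]
  have hint : Integrable (fun ω => Real.exp (1 * (∑ t ∈ Finset.range m, Y t) ω)) P := by
    refine Integrable.of_bound (C := Real.exp m) ?_ (.of_forall fun ω => ?_)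
    · rw [← hsum]
      exact (((Finset.measurable_sum _ fun t _ => hmeas t).const_mul 1).exp).aestronglyMeasurable
    · rw [Real.norm_of_nonneg (Real.exp_pos _).le, Real.exp_le_exp, one_mul, Finset.sum_apply]
      calc ∑ t ∈ Finset.range m, Y t ω ≤ ∑ t ∈ Finset.range m, (1 : ℝ) := by
            refine Finset.sum_le_sum fun t _ => ?_
            simp only [Y]
            split_ifs <;> norm_num
        _ = m := by simp
  have key := measure_ge_le_exp_mul_mgf (μ := P) (X := ∑ t ∈ Finset.range m, Y t) a zero_le_one hint
  rw [hind.mgf_sum hmeas] at key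
  have hset : {ω | a ≤ ∑ t ∈ Finset.range m, if R (v, t) ω = .rest then (0 : ℝ) else 1} =
      {ω | a ≤ (∑ t ∈ Finset.range m, Y t) ω} := by
    ext ω
    simp [Y]
  rw [hset]
  refine key.trans ?_
  rw [sub_eq_add_neg, Real.exp_add, mul_comm, Finset.mul_sum, Real.exp_sum, neg_one_mul]
  refine mul_le_mul_of_nonneg_right ?_ (Real.exp_pos _).le
  exact Finset.prod_le_prod (fun t _ => mgf_nonneg) fun t ht => hmgf t (Finset.mem_range.1 ht)

end Random

end MatchingAlgorithm

/-! ### From uniform draws to independent roles -/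

namespace MatchingAlgorithm

theorem measureReal_preimage_of_isUniform {Ω : Type*} [MeasurableSpace Ω] {P : Measure Ω}
    {X : Ω → ℝ} (hX : pdf.IsUniform X (Set.Icc 0 1) P volume) {A : Set ℝ} (hA : MeasurableSet A) :
    P.real (X ⁻¹' A) = volume.real (Set.Icc 0 1 ∩ A) := by
  rw [measureReal_def, hX.measure_preimage (by simp) (by simp) hA]
  simp [measureReal_def]

theorem measurable_roleOf (C : ℝ) (n t : ℕ) : Measurable (roleOf C n t) := by
  unfold roleOf
  refine Measurable.ite measurableSet_Iic measurable_const ?_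
  exact Measurable.ite measurableSet_Iic measurable_const measurable_const

theorem isRoleFamily_of_isUniform {V Ω : Type*} [MeasurableSpace Ω] {P : Measure Ω}
    {X : V → ℕ → Ω → ℝ} (hmeas : ∀ v s, Measurable (X v s))
    (hind : iIndepFun (fun i : V × ℕ => X i.1 i.2) P)
    (hunif : ∀ v s, pdf.IsUniform (X v s) (Set.Icc 0 1) P volume) {C : ℝ} {n m : ℕ}
    (hrate : ∀ t < m, 0 ≤ rate C n (t + 1) ∧ rate C n (t + 1) ≤ 1) :
    IsRoleFamily (fun i : V × ℕ => fun ω => roleOf C n (i.2 + 1) (X i.1 (3 * i.2) ω)) P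
      (fun t => rate C n (t + 1)) m where
  measurable i := (measurable_roleOf C n _).comp (hmeas _ _)
  indep := by
    have h1 : iIndepFun (fun i : V × ℕ => X i.1 (3 * i.2)) P :=
      hind.precomp (g := fun i : V × ℕ => (i.1, 3 * i.2)) fun a b hab => by
        simp only [Prod.mk.injEq] at hab
        exact Prod.ext hab.1 (by omega)
    exact h1.comp (fun i => roleOf C n (i.2 + 1)) fun i => measurable_roleOf C n _
  recruit v t ht := by
    obtain ⟨h0, h1⟩ := hrate t ht
    have e : (fun ω => roleOf C n (t + 1) (X v (3 * t) ω)) ⁻¹' {.recruit} =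
        X v (3 * t) ⁻¹' Set.Iic (rate C n (t + 1) / 2) := by
      ext ω
      simp only [Set.mem_preimage, Set.mem_singleton_iff, roleOf, Set.mem_Iic]
      split_ifs <;> simp_all
    have e' : Set.Icc (0 : ℝ) 1 ∩ Set.Iic (rate C n (t + 1) / 2) =
        Set.Icc 0 (rate C n (t + 1) / 2) := by
      ext y
      simp only [Set.mem_inter_iff, Set.mem_Icc, Set.mem_Iic]
      constructor
      · tauto
      · rintro ⟨h2, h3⟩
        exact ⟨⟨h2, by linarith⟩, h3⟩
    simp only [e]
    rw [measureReal_preimage_of_isUniform (hunif _ _) measurableSet_Iic, e',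
      Real.volume_real_Icc_of_le (by linarith), sub_zero]
  accept v t ht := by
    obtain ⟨h0, h1⟩ := hrate t ht
    have e : (fun ω => roleOf C n (t + 1) (X v (3 * t) ω)) ⁻¹' {.accept} =
        X v (3 * t) ⁻¹' Set.Ioc (rate C n (t + 1) / 2) (rate C n (t + 1)) := by
      ext ω
      simp only [Set.mem_preimage, Set.mem_singleton_iff, roleOf, Set.mem_Ioc]
      split_ifs with h2 h3
      · simp [h2]
      · simp [h3, not_le.1 h2]
      · simp [h3]
    have e' : Set.Icc (0 : ℝ) 1 ∩ Set.Ioc (rate C n (t + 1) / 2) (rate C n (t + 1)) =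
        Set.Ioc (rate C n (t + 1) / 2) (rate C n (t + 1)) := by
      refine Set.inter_eq_right.2 fun y hy => ⟨?_, ?_⟩
      · linarith [hy.1]
      · linarith [hy.2]
    simp only [e]
    rw [measureReal_preimage_of_isUniform (hunif _ _) measurableSet_Ioc, e',
      Real.volume_real_Ioc_of_le (by linarith)]
    ring
  rest v t ht := by
    obtain ⟨h0, h1⟩ := hrate t ht
    have e : (fun ω => roleOf C n (t + 1) (X v (3 * t) ω)) ⁻¹' {.rest} =
        X v (3 * t) ⁻¹' Set.Ioi (rate C n (t + 1)) := by
      ext ω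
      simp only [Set.mem_preimage, Set.mem_singleton_iff, roleOf, Set.mem_Ioi]
      split_ifs with h2 h3
      · simp only [false_iff, not_lt]
        linarith
      · simp [h3]
      · simp [not_le.1 h3]
    have e' : Set.Icc (0 : ℝ) 1 ∩ Set.Ioi (rate C n (t + 1)) = Set.Ioc (rate C n (t + 1)) 1 := by
      ext y
      simp only [Set.mem_inter_iff, Set.mem_Icc, Set.mem_Ioi, Set.mem_Ioc]
      constructor
      · tauto
      · rintro ⟨h2, h3⟩
        exact ⟨⟨by linarith, h3⟩, h2⟩
    simp only [e]
    rw [measureReal_preimage_of_isUniform (hunif _ _) measurableSet_Ioi, e',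
      Real.volume_real_Ioc_of_le h1]

/-- The exponent in the failure probability of a window of rounds. -/
noncomputable def windowConst : ℝ := 9 / 200 * Real.exp (-96)

theorem windowConst_pos : 0 < windowConst := by
  unfold windowConst
  positivity

theorem windowConst_le : windowConst ≤ 9 / 200 := by
  have : Real.exp (-96) ≤ 1 := Real.exp_le_one_iff.2 (by norm_num)
  unfold windowConst
  linarith

/-! ### Numerical estimates for windows and for the total failure probability -/

section Numerics

variable {L k : ℝ}

/-- Here y is the rate's denominator within a window of s + k rounds that ends k rounds before the
last. The bound y ≥ 4L + k gives rΔ ≤ 12, hence the factor exp(-96); the bound y ≤ 5L + 2k keeps r²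
large. -/
theorem window_rate {s Δ y : ℝ} (hL : 1 ≤ L) (hk : 0 ≤ k) (hs : s ≤ L)
    (hΔ : Δ = 1 + 2 * (2 * k + s) / L) (hy : 4 * L + k ≤ y) (hy' : y ≤ 5 * L + 2 * k) :
    9 / 4 * (L * (L + 2 * k) / (5 * L + 2 * k) ^ 2) * Real.exp (-96) ≤
      (1 + 2 * k / L) * ((3 * L / y / 2) ^ 2 * Real.exp (-(8 * (3 * L / y) * Δ))) := by
  have hL0 : 0 < L := by linarith
  have hy0 : 0 < y := by linarith
  have h1 : 3 * L / y * Δ ≤ 12 := by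
    have : 3 * L / y * Δ = 3 * (L + 2 * (2 * k + s)) / y := by
      rw [hΔ]
      field_simp
    rw [this, div_le_iff₀ hy0]
    linarith
  have h2 : Real.exp (-96) ≤ Real.exp (-(8 * (3 * L / y) * Δ)) := by
    rw [Real.exp_le_exp]
    linarith
  have h3 : 9 / 4 * (L * (L + 2 * k) / (5 * L + 2 * k) ^ 2) ≤
      (1 + 2 * k / L) * (3 * L / y / 2) ^ 2 := by
    have e : (1 + 2 * k / L) * (3 * L / y / 2) ^ 2 = 9 / 4 * (L * (L + 2 * k) / y ^ 2) := by
      field_simp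
      ring
    rw [e]
    gcongr
  rw [← mul_assoc]
  exact mul_le_mul h3 h2 (Real.exp_pos _).le (by positivity)

theorem window_prob_le_one (hL : 1 ≤ L) (hk : 0 ≤ k) :
    9 / 4 * (L * (L + 2 * k) / (5 * L + 2 * k) ^ 2) * Real.exp (-96) ≤ 1 := by
  have h1 : Real.exp (-96) ≤ 1 := Real.exp_le_one_iff.2 (by norm_num)
  have h2 : 9 / 4 * (L * (L + 2 * k) / (5 * L + 2 * k) ^ 2) ≤ 1 := by
    rw [← mul_div_assoc, div_le_one (by positivity)]
    nlinarith
  have h3 : 0 ≤ 9 / 4 * (L * (L + 2 * k) / (5 * L + 2 * k) ^ 2) := by positivity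
  nlinarith [Real.exp_pos (-96)]

/-- The ratio (L + k)(L + 2k)/(5L + 2k)² is at least its value 1/25 at k = 0. So the window length
cancels the decay of the pairing probability, uniformly in k. -/
theorem window_exponent {s : ℝ} (hL : 1 ≤ L) (hk : 0 ≤ k) (hs : L / 2 ≤ s) :
    windowConst * L ≤
      (s + k) * (9 / 4 * (L * (L + 2 * k) / (5 * L + 2 * k) ^ 2) * Real.exp (-96)) := by
  have hL0 : 0 < L := by linarith
  have h1 : 1 / 25 ≤ (L + k) * (L + 2 * k) / (5 * L + 2 * k) ^ 2 := by
    rw [le_div_iff₀ (by positivity)]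
    nlinarith [mul_nonneg hL0.le hk]
  have h2 : (L + k) / 2 ≤ s + k := by linarith
  have h3 : 0 ≤ 9 / 4 * (L * (L + 2 * k) / (5 * L + 2 * k) ^ 2) * Real.exp (-96) := by positivity
  refine le_trans ?_ (mul_le_mul_of_nonneg_right h2 h3)
  have e : (L + k) / 2 * (9 / 4 * (L * (L + 2 * k) / (5 * L + 2 * k) ^ 2) * Real.exp (-96)) =
      9 / 8 * L * Real.exp (-96) * ((L + k) * (L + 2 * k) / (5 * L + 2 * k) ^ 2) := by ring
  rw [e]
  have h4 : 0 ≤ 9 / 8 * L * Real.exp (-96) := by positivity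
  calc windowConst * L = 9 / 8 * L * Real.exp (-96) * (1 / 25) := by
        unfold windowConst
        ring
    _ ≤ _ := mul_le_mul_of_nonneg_left h1 h4

/-- Telescoping: log x ≤ x - 1 at the ratio of consecutive arguments bounds each reciprocal by a
difference of logarithms. -/
theorem sum_inv_le_log {A : ℝ} (j : ℕ) (hA : (j : ℝ) < A - 1) :
    ∑ t ∈ Finset.range j, (A - (t + 1 : ℕ))⁻¹ ≤ Real.log (A - 1) - Real.log (A - 1 - j) := by
  induction j with
  | zero => simp
  | succ j ih =>
    push_cast at hA
    rw [Finset.sum_range_succ]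
    have ih := ih (by linarith)
    have h1 : 0 < A - 1 - j := by linarith
    have h2 : 0 < A - 1 - j - 1 := by linarith
    have h3 := Real.log_le_sub_one_of_pos (div_pos h2 h1)
    rw [Real.log_div h2.ne' h1.ne'] at h3
    have h4 : (A - 1 - j - 1) / (A - 1 - j) - 1 = -(A - ((j + 1 : ℕ) : ℝ))⁻¹ := by
      push_cast
      rw [show A - ((j : ℝ) + 1) = A - 1 - j by ring]
      field_simp
      ring
    rw [h4] at h3
    have h5 : A - 1 - ((j + 1 : ℕ) : ℝ) = A - 1 - j - 1 := by
      push_cast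
      ring
    rw [h5]
    linarith

theorem failure_le {C : ℝ} (hC : 128 / windowConst ^ 2 ≤ C) {n m : ℕ} (hn : 2 ≤ n)
    (hm : (m : ℝ) ≤ n * (C * Real.log n)) :
    n * ((m + 1) * Real.exp (-(windowConst * (C * Real.log n)))) +
      n * Real.exp (-(3 / 2 * (C * Real.log n) * Real.log n)) ≤ 1 / (n : ℝ) ^ 2 := by
  set c := windowConst with hc
  have hc0 : 0 < c := windowConst_pos
  have hc1 : c ≤ 9 / 200 := windowConst_le
  rw [div_le_iff₀ (by positivity)] at hC
  have hC0 : 0 < C := by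
    by_contra hneg
    nlinarith [sq_nonneg c]
  have hcC : 128 ≤ c * C := by nlinarith [mul_pos hC0 hc0]
  have hC1 : 128 ≤ C := by nlinarith
  have hn' : (2 : ℝ) ≤ n := by exact_mod_cast hn
  have hn0 : (0 : ℝ) < n := by linarith
  set l := Real.log n with hl
  have hl2 : 1 / 2 ≤ l := by
    have h1 := Real.log_two_gt_d9
    have h2 : Real.log 2 ≤ l := Real.log_le_log (by norm_num) hn'
    linarith
  have hln : l ≤ n := (Real.log_le_sub_one_of_pos hn0).trans (by linarith)
  have hpow : ∀ j : ℕ, (n : ℝ) ^ j = Real.exp (j * l) := by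
    intro j
    rw [Real.exp_nat_mul, Real.exp_log hn0]
  have h1 : 4 * C * n ^ 5 ≤ Real.exp (c * (C * l)) := by
    -- This fixes the constant 128/c²: the quadratic term of exp(cC/4) is c²C²/32, which is at least
    -- 4C exactly when C ≥ 128/c² for positive C.
    have h2 : 4 * C ≤ Real.exp (c * C / 4) := by
      have := Real.quadratic_le_exp_of_nonneg (show 0 ≤ c * C / 4 by positivity)
      nlinarith
    have h3 : Real.exp (c * (C * l)) = Real.exp (c * C * l - 5 * l) * Real.exp ((5 : ℕ) * l) := by
      rw [← Real.exp_add]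
      congr 1
      push_cast
      ring
    rw [h3, ← hpow]
    refine mul_le_mul_of_nonneg_right (h2.trans ?_) (by positivity)
    rw [Real.exp_le_exp]
    nlinarith
  have h2 : 2 * (n : ℝ) ^ 3 ≤ Real.exp (3 / 2 * (C * l) * l) := by
    have h3 : 2 * (n : ℝ) ^ 3 ≤ n ^ 4 := by
      rw [pow_succ (n : ℝ) 3, mul_comm]
      gcongr
    refine h3.trans ?_
    rw [hpow, Real.exp_le_exp]
    push_cast
    have h4 : 64 ≤ C * l := by nlinarith
    nlinarith
  have hm' : (m : ℝ) + 1 ≤ 2 * C * n ^ 2 := by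
    have h3 : n * (C * l) ≤ n * (C * n) := by gcongr
    nlinarith [mul_pos hC0 hn0]
  have e1 : n * ((m + 1) * Real.exp (-(c * (C * l)))) ≤ 1 / (2 * (n : ℝ) ^ 2) := by
    rw [Real.exp_neg, ← mul_assoc, ← div_eq_mul_inv, div_le_div_iff₀ (Real.exp_pos _) (by positivity),
      one_mul]
    refine le_trans ?_ h1
    calc (n : ℝ) * (m + 1) * (2 * n ^ 2) ≤ n * (2 * C * n ^ 2) * (2 * n ^ 2) := by gcongr
      _ = 4 * C * n ^ 5 := by ring
  have e2 : n * Real.exp (-(3 / 2 * (C * l) * l)) ≤ 1 / (2 * (n : ℝ) ^ 2) := by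
    rw [Real.exp_neg, ← div_eq_mul_inv, div_le_div_iff₀ (Real.exp_pos _) (by positivity), one_mul]
    refine le_trans (le_of_eq ?_) h2
    ring
  have e3 : 1 / (n : ℝ) ^ 2 = 1 / (2 * (n : ℝ) ^ 2) + 1 / (2 * (n : ℝ) ^ 2) := by
    field_simp
    norm_num
  linarith

end Numerics

/-! ### Bounds on the participation rate -/

section Rates

variable {C : ℝ} {n : ℕ}

theorem rate_eq (t : ℕ) : rate C n t =
    3 * (C * Real.log n) / (4 * (C * Real.log n) + n * (C * Real.log n) - t) := by
  rw [rate, tmax]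
  ring_nf

theorem rate_bounds (hL : 1 ≤ C * Real.log n) {t : ℕ} (ht : (t : ℝ) ≤ n * (C * Real.log n)) :
    0 ≤ rate C n t ∧ rate C n t ≤ 3 / 4 := by
  rw [rate_eq]
  have h : 0 < 4 * (C * Real.log n) + n * (C * Real.log n) - t := by linarith
  refine ⟨by positivity, ?_⟩
  rw [div_le_iff₀ h]
  linarith

theorem sum_rate_le (hn : 2 ≤ n) (hL : 1 ≤ C * Real.log n) {m : ℕ}
    (hm : (m : ℝ) ≤ n * (C * Real.log n)) :
    ∑ t ∈ Finset.range m, rate C n (t + 1) ≤ 3 * (C * Real.log n) * Real.log n := by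
  set L := C * Real.log n with hLdef
  have hn' : (2 : ℝ) ≤ n := by exact_mod_cast hn
  have h1 := sum_inv_le_log (A := 4 * L + n * L) m (by linarith)
  simp only [rate_eq, div_eq_mul_inv, ← Finset.mul_sum]
  refine mul_le_mul_of_nonneg_left (h1.trans ?_) (by linarith)
  rw [← Real.log_div (by nlinarith) (by linarith)]
  have h2 : 0 < 4 * L + n * L - 1 - m := by linarith
  -- The ratio is at most (4L + nL - 1)/(4L - 1), which is at most n because n ≥ 2 and L ≥ 1.
  refine Real.log_le_log (div_pos (by nlinarith) h2) ?_
  rw [div_le_iff₀ h2]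
  nlinarith

end Rates

/-! ### The degree bound and the energy bound with high probability -/

section Failure

variable {V : Type*} [Fintype V] {G : SimpleGraph V} {Ω : Type*} [MeasurableSpace Ω]
  {P : Measure Ω} [IsProbabilityMeasure P] {R : V × ℕ → Ω → Role} {C : ℝ} {n m : ℕ}

/-- The degree threshold after `t` of `m` rounds. -/
noncomputable def threshold (L : ℝ) (m t : ℕ) : ℝ := 1 + 2 * ((m : ℝ) - t) / L

/-- If nodes are not crowded at the beginning of a window of rounds, a node is unlikely to be
crowded at its end. -/
theorem IsRoleFamily.measureReal_window_le (h : IsRoleFamily R P (fun t => rate C n (t + 1)) m)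
    (hL : 1 ≤ C * Real.log n) (hm : (m : ℝ) ≤ n * (C * Real.log n))
    (hm' : n * (C * Real.log n) < m + 1) {t : ℕ} (ht : t ≤ m)
    (hwin : m + ⌊C * Real.log n⌋₊ ≤ 2 * t) (v : V) :
    P.real {ω | (∀ w, ¬ Crowded G (partners G (history R ω) (2 * t - m - ⌊C * Real.log n⌋₊))
        (threshold (C * Real.log n) m (2 * t - m - ⌊C * Real.log n⌋₊)) w) ∧
      Crowded G (partners G (history R ω) t) (threshold (C * Real.log n) m t) v} ≤
      Real.exp (-(windowConst * (C * Real.log n))) := by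
  set L := C * Real.log n with hLdef
  set ℓ := ⌊L⌋₊ with hℓ
  have hℓ1 : (ℓ : ℝ) ≤ L := Nat.floor_le (by linarith)
  have hℓ2 : L / 2 ≤ ℓ := by
    have h1 : L < ℓ + 1 := Nat.lt_floor_add_one L
    have h2 : (1 : ℝ) ≤ ℓ := by exact_mod_cast (Nat.one_le_floor_iff L).2 hL
    linarith
  obtain ⟨k, hk⟩ := Nat.exists_eq_add_of_le ht
  obtain ⟨t₀, ht₀⟩ := Nat.exists_eq_add_of_le hwin
  have e0 : 2 * t - m - ℓ = t₀ := by omega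
  -- The window has ⌊L⌋ + k rounds, where k rounds remain after `t`; at its start 2k + ⌊L⌋ remain.
  have e1 : t₀ + (ℓ + k) = t := by omega
  have e1' : (t₀ : ℝ) + (ℓ + k) = t := by exact_mod_cast e1
  have hk' : (m : ℝ) = t + k := by exact_mod_cast hk
  have hk0 : (0 : ℝ) ≤ k := k.cast_nonneg
  have key := h.measureReal_crowded_le (G := G) (t₀ := t₀) (s := ℓ + k) (by omega)
    (D := threshold L m t) (Δ := threshold L m t₀) (window_prob_le_one hL hk0) ?_ v
  · rw [e1] at key
    rw [e0]
    refine key.trans ?_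
    rw [Real.exp_le_exp, neg_le_neg_iff]
    push_cast
    exact window_exponent hL hk0 hℓ2
  · intro t' h1 h2
    have h1' : (t₀ : ℝ) ≤ t' := by exact_mod_cast h1
    have h2' : (t' : ℝ) + 1 ≤ t := by
      rw [e1] at h2
      exact_mod_cast h2
    obtain ⟨r0, r1⟩ := rate_bounds (C := C) (n := n) hL (t := t' + 1) (by push_cast; linarith)
    refine ⟨r0, r1, ?_⟩
    have hD : threshold L m t = 1 + 2 * k / L := by
      rw [threshold, hk']
      ring_nf
    rw [hD, rate_eq]
    refine window_rate hL hk0 hℓ1 ?_ ?_ ?_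
    · rw [threshold, hk', ← e1']
      ring_nf
    · push_cast
      linarith
    · push_cast
      linarith

theorem card_freeNeighbors_add_one_le (π : V → Option V) (v : V) :
    (freeNeighbors G π v).card + 1 ≤ Fintype.card V := by
  classical
  have h : v ∉ freeNeighbors G π v := by
    rw [mem_freeNeighbors]
    exact fun h => h.1.ne rfl
  rw [← Finset.card_insert_of_notMem h]
  exact Finset.card_le_univ _

/-- With high probability no node is crowded in the end. -/
theorem IsRoleFamily.measureReal_crowded_end_le
    (h : IsRoleFamily R P (fun t => rate C n (t + 1)) m)
    (hn : n = Fintype.card V) (hL : 1 ≤ C * Real.log n) (hm : (m : ℝ) ≤ n * (C * Real.log n))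
    (hm' : n * (C * Real.log n) < m + 1) :
    P.real {ω | ∃ v, Crowded G (partners G (history R ω) m) 1 v} ≤
      n * ((m + 1) * Real.exp (-(windowConst * (C * Real.log n)))) := by
  classical
  set L := C * Real.log n with hLdef
  set ℓ := ⌊L⌋₊ with hℓ
  have hℓ1 : (ℓ : ℝ) ≤ L := Nat.floor_le (by linarith)
  let bad : V × ℕ → Set Ω := fun i => if m + ℓ ≤ 2 * i.2 then
    {ω | (∀ w, ¬ Crowded G (partners G (history R ω) (2 * i.2 - m - ℓ))
        (threshold L m (2 * i.2 - m - ℓ)) w) ∧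
      Crowded G (partners G (history R ω) i.2) (threshold L m i.2) i.1} else ∅
  have hsub : {ω | ∃ v, Crowded G (partners G (history R ω) m) 1 v} ⊆
      ⋃ i ∈ (Finset.univ ×ˢ Finset.range (m + 1) : Finset (V × ℕ)), bad i := by
    intro ω hω
    -- Take the first time at which some node violates the threshold.
    let Q : ℕ → Prop := fun t =>
      t ≤ m ∧ ∃ v, Crowded G (partners G (history R ω) t) (threshold L m t) v
    have hQ : ∃ t, Q t := ⟨m, le_rfl, by simpa [threshold] using hω⟩
    obtain ⟨ht, v, hv⟩ := Nat.find_spec hQ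
    set t := Nat.find hQ with htdef
    simp only [Set.mem_iUnion]
    refine ⟨(v, t), by simp; omega, ?_⟩
    have hwin : m + ℓ ≤ 2 * t := by
      -- Otherwise the window would start before time 0; but then the threshold exceeds n - 1, more
      -- than any degree.
      by_contra hlt
      have h1 : (2 : ℝ) * t + 1 ≤ m + ℓ := by exact_mod_cast not_le.1 hlt
      have h2 := hv.2
      have h3 : ((freeNeighbors G (partners G (history R ω) t) v).card : ℝ) + 1 ≤ n := by
        rw [hn]
        exact_mod_cast card_freeNeighbors_add_one_le _ v
      have h4 : (n : ℝ) - 2 < 2 * ((m : ℝ) - t) / L := by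
        rw [lt_div_iff₀ (by linarith)]
        nlinarith
      rw [threshold] at h2
      linarith
    simp only [bad, if_pos hwin]
    refine ⟨fun w hw => ?_, hv⟩
    have hℓ0 : 1 ≤ ℓ := (Nat.one_le_floor_iff L).2 hL
    -- The window is nonempty because ⌊L⌋ ≥ 1, so its start precedes the first violation.
    exact Nat.find_min hQ (m := 2 * t - m - ℓ) (by omega) ⟨by omega, w, hw⟩
  calc _ ≤ P.real (⋃ i ∈ (Finset.univ ×ˢ Finset.range (m + 1) : Finset (V × ℕ)), bad i) :=
        measureReal_mono hsub (measure_ne_top _ _)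
    _ ≤ ∑ i ∈ (Finset.univ ×ˢ Finset.range (m + 1) : Finset (V × ℕ)), P.real (bad i) :=
        measureReal_biUnion_finset_le _ _
    _ ≤ ∑ i ∈ (Finset.univ ×ˢ Finset.range (m + 1) : Finset (V × ℕ)),
          Real.exp (-(windowConst * L)) := by
        refine Finset.sum_le_sum fun i hi => ?_
        rw [Finset.mem_product, Finset.mem_range] at hi
        simp only [bad]
        split_ifs with hwin
        · exact h.measureReal_window_le hL hm hm' (by omega) hwin i.1
        · simpa using (Real.exp_pos _).le
    _ = n * ((m + 1) * Real.exp (-(windowConst * L))) := by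
        rw [Finset.sum_const, Finset.card_product, Finset.card_univ, Finset.card_range, ← hn,
          nsmul_eq_mul]
        push_cast
        ring

open Classical in
/-- With high probability every node participates in few rounds only. -/
theorem IsRoleFamily.measureReal_participation_gt_le
    (h : IsRoleFamily R P (fun t => rate C n (t + 1)) m) (hn : n = Fintype.card V) (hn2 : 2 ≤ n)
    (hL : 1 ≤ C * Real.log n) (hm : (m : ℝ) ≤ n * (C * Real.log n)) :
    P.real {ω | ∃ v, 20 / 3 * (C * Real.log n) * Real.log n <
        ∑ t ∈ Finset.range m, if R (v, t) ω = .rest then (0 : ℝ) else 1} ≤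
      n * Real.exp (-(3 / 2 * (C * Real.log n) * Real.log n)) := by
  set L := C * Real.log n with hLdef
  have hlog : 0 ≤ Real.log n := Real.log_natCast_nonneg n
  have hsub : {ω | ∃ v, 20 / 3 * L * Real.log n <
        ∑ t ∈ Finset.range m, if R (v, t) ω = .rest then (0 : ℝ) else 1} ⊆
      ⋃ v ∈ (Finset.univ : Finset V), {ω | 20 / 3 * L * Real.log n ≤
        ∑ t ∈ Finset.range m, if R (v, t) ω = .rest then (0 : ℝ) else 1} := by
    rintro ω ⟨v, hv⟩
    simp only [Set.mem_iUnion]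
    exact ⟨v, Finset.mem_univ v, hv.le⟩
  refine (measureReal_mono hsub (measure_ne_top _ _)).trans ((measureReal_biUnion_finset_le _ _).trans ?_)
  calc _ ≤ ∑ v ∈ (Finset.univ : Finset V), Real.exp (-(3 / 2 * L * Real.log n)) := by
        refine Finset.sum_le_sum fun v _ => (h.measureReal_participation_le v _).trans ?_
        rw [Real.exp_le_exp]
        have h1 := sum_rate_le hn2 hL hm
        have h2 := Real.exp_one_lt_d9
        have h3 := Real.exp_one_gt_d9
        have h4 : 0 ≤ L * Real.log n := by positivity
        -- Numerically 20/3 - 3(e - 1) > 3/2.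
        calc _ ≤ (Real.exp 1 - 1) * (3 * L * Real.log n) - 20 / 3 * L * Real.log n := by
              gcongr
              linarith
          _ ≤ _ := by nlinarith
    _ = _ := by
        rw [Finset.sum_const, Finset.card_univ, ← hn, nsmul_eq_mul]

end Failure

end MatchingAlgorithm

/-! ### Assembling the success probability -/

namespace MatchingAlgorithm

variable {V : Type*} [Fintype V] {G : SimpleGraph V} {ident : V → ℕ} {C : ℝ} {n : ℕ}

/-- An execution succeeds when no node is crowded in the end, and no node participates in too many
rounds. -/
theorem success_of_roles (hid : Function.Injective ident) (hC : 0 ≤ tmax C n) (x : V → ℕ → ℝ)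
    (h : ¬ ∃ v, Crowded G (partners G (roles C n x) ⌊tmax C n⌋₊) 1 v)
    (h' : ¬ ∃ v, 20 / 3 * (C * Real.log n) * Real.log n < ∑ t ∈ Finset.range ⌊tmax C n⌋₊,
      open Classical in if roles C n x t v = .rest then (0 : ℝ) else 1) :
    Maximal (fun N : G.Subgraph => N.IsMatching)
        (matching G (partners G (roles C n x) ⌊tmax C n⌋₊)) ∧
      ∀ v : V, (energy (program C n) G ident x (3 * ⌊tmax C n⌋₊) v : ℝ) ≤
        20 * C * (Real.log n) ^ 2 := by
  classical
  refine ⟨matching_maximal (partners_symm _ _) fun v w hvw hv hw => ?_, fun v => ?_⟩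
  · refine h ⟨v, hv, ?_⟩
    have : 0 < (freeNeighbors G (partners G (roles C n x) ⌊tmax C n⌋₊) v).card :=
      Finset.card_pos.2 ⟨w, mem_freeNeighbors.2 ⟨hvw, hw⟩⟩
    exact_mod_cast this
  · have h1 := energy_le (G := G) (x := x) hid v (Nat.floor_le hC)
    have h2 := not_lt.1 (not_exists.1 h' v)
    have h3 : (energy (program C n) G ident x (3 * ⌊tmax C n⌋₊) v : ℝ) ≤
        3 * ∑ t ∈ Finset.range ⌊tmax C n⌋₊, if roles C n x t v = .rest then (0 : ℝ) else 1 := by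
      exact_mod_cast h1
    refine h3.trans ((mul_le_mul_of_nonneg_left h2 (by norm_num)).trans (le_of_eq ?_))
    ring

/-- For networks with at least two nodes, the algorithm succeeds with high probability. -/
theorem success_probability (hid : Function.Injective ident) (hn : n = Fintype.card V)
    (hn2 : 2 ≤ n) (hC : 128 / windowConst ^ 2 ≤ C) {Ω : Type*} [MeasurableSpace Ω]
    {P : Measure Ω} [IsProbabilityMeasure P] {X : V → ℕ → Ω → ℝ}
    (hmeas : ∀ v s, Measurable (X v s)) (hind : iIndepFun (fun i : V × ℕ => X i.1 i.2) P)
    (hunif : ∀ v s, pdf.IsUniform (X v s) (Set.Icc 0 1) P volume) :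
    1 - 1 / (n : ℝ) ^ 2 ≤
      P.real {ω | Maximal (fun N : G.Subgraph => N.IsMatching)
          (matching G (partners G (roles C n fun v s => X v s ω) ⌊tmax C n⌋₊)) ∧
        ∀ v : V, (energy (program C n) G ident (fun v s => X v s ω) (3 * ⌊tmax C n⌋₊) v : ℝ) ≤
          20 * C * (Real.log n) ^ 2} := by
  classical
  have hC2 : 2 ≤ C := by
    refine le_trans ?_ hC
    have h1 := windowConst_pos
    have h2 := windowConst_le
    rw [le_div_iff₀ (by positivity)]
    nlinarith
  have hL : 1 ≤ C * Real.log n := by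
    have h1 := Real.log_two_gt_d9
    have h2 : Real.log 2 ≤ Real.log n := Real.log_le_log (by norm_num) (by exact_mod_cast hn2)
    nlinarith
  have htmax : tmax C n = n * (C * Real.log n) := by
    rw [tmax]
    ring
  have ht0 : 0 ≤ tmax C n := by
    rw [htmax]
    positivity
  have hm : (⌊tmax C n⌋₊ : ℝ) ≤ n * (C * Real.log n) := htmax ▸ Nat.floor_le ht0
  have hm' : n * (C * Real.log n) < ⌊tmax C n⌋₊ + 1 := htmax ▸ Nat.lt_floor_add_one (tmax C n)
  have hfam := isRoleFamily_of_isUniform hmeas hind hunif (C := C) (n := n) (m := ⌊tmax C n⌋₊)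
    fun t ht => by
      have h1 : ((t + 1 : ℕ) : ℝ) ≤ ⌊tmax C n⌋₊ := by exact_mod_cast ht
      obtain ⟨h2, h3⟩ := rate_bounds hL (h1.trans hm)
      exact ⟨h2, by linarith⟩
  have b1 := hfam.measureReal_crowded_end_le (G := G) hn hL hm hm'
  have b2 := hfam.measureReal_participation_gt_le hn hn2 hL hm
  have b3 := failure_le hC hn2 hm
  set S₁ := {ω | ∃ v, Crowded G (partners G (history (fun i : V × ℕ => fun ω =>
    roleOf C n (i.2 + 1) (X i.1 (3 * i.2) ω)) ω) ⌊tmax C n⌋₊) 1 v} with hS₁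
  set S₂ := {ω | ∃ v : V, 20 / 3 * (C * Real.log n) * Real.log n <
    ∑ t ∈ Finset.range ⌊tmax C n⌋₊,
      if roleOf C n (t + 1) (X v (3 * t) ω) = .rest then (0 : ℝ) else 1} with hS₂
  set S := {ω | Maximal (fun N : G.Subgraph => N.IsMatching)
      (matching G (partners G (roles C n fun v s => X v s ω) ⌊tmax C n⌋₊)) ∧
    ∀ v : V, (energy (program C n) G ident (fun v s => X v s ω) (3 * ⌊tmax C n⌋₊) v : ℝ) ≤
      20 * C * (Real.log n) ^ 2} with hS
  -- Covering the space and using subadditivity requires no measurability of the success event.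
  have hcover : Set.univ ⊆ S ∪ (S₁ ∪ S₂) := by
    intro ω _
    by_cases h1 : ω ∈ S₁
    · exact Or.inr (Or.inl h1)
    by_cases h2 : ω ∈ S₂
    · exact Or.inr (Or.inr h2)
    exact Or.inl (success_of_roles hid ht0 (fun v s => X v s ω) h1 h2)
  have h1 : 1 ≤ P.real S + (P.real S₁ + P.real S₂) := by
    calc (1 : ℝ) = P.real Set.univ := by simp
      _ ≤ P.real (S ∪ (S₁ ∪ S₂)) := measureReal_mono hcover (measure_ne_top _ _)
      _ ≤ P.real S + P.real (S₁ ∪ S₂) := measureReal_union_le _ _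
      _ ≤ P.real S + (P.real S₁ + P.real S₂) := by
        gcongr
        exact measureReal_union_le _ _
  linarith

end MatchingAlgorithm

theorem theorem1 :
    ∃ C₀ : ℝ, 0 < C₀ ∧ ∀ C : ℝ, C₀ ≤ C →
      ∀ (V : Type*) [Fintype V] (G : SimpleGraph V) (ident : V → ℕ) (_ : Function.Injective ident)
        (n : ℕ) (_ : n = Fintype.card V),
      ∃ (T : ℕ) (M : (V → ℕ → ℝ) → G.Subgraph),
        (T : ℝ) ≤ 3 * C * n * Real.log n ∧
        -- always, i.e. whatever the nodes draw:
        (∀ x : V → ℕ → ℝ,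
          -- every node has terminated after `T` timesteps, stays so, and stays asleep,
          (∀ s : ℕ, T ≤ s → ∀ v : V,
            (config (MatchingAlgorithm.program C n) G ident x s v).control = .halted ∧
            config (MatchingAlgorithm.program C n) G ident x s v =
              config (MatchingAlgorithm.program C n) G ident x T v ∧
            actionAt (MatchingAlgorithm.program C n) G ident x s v = .sleep) ∧
          -- `M x` is a matching, and each node then knows its partner in it
          (M x).IsMatching ∧
          (∀ v w : V,
            (config (MatchingAlgorithm.program C n) G ident x T v).partner = some (ident w) ↔
              (M x).Adj v w) ∧
          (∀ v : V,
            (config (MatchingAlgorithm.program C n) G ident x T v).partner = none ↔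
              v ∉ (M x).verts)) ∧
        -- when the draws are independent and uniform in `[0, 1]`:
        (∀ (Ω : Type*) [MeasurableSpace Ω] (P : Measure Ω) [IsProbabilityMeasure P]
          (X : V → ℕ → Ω → ℝ), (∀ v s, Measurable (X v s)) →
          iIndepFun (fun i : V × ℕ => X i.1 i.2) P →
          (∀ v s, pdf.IsUniform (X v s) (Set.Icc 0 1) P volume) →
          1 - 1 / (n : ℝ) ^ 2 ≤
            P.real {ω | Maximal (fun N : G.Subgraph => N.IsMatching) (M (fun v s => X v s ω)) ∧
              ∀ v : V, (energy (MatchingAlgorithm.program C n) G ident (fun v s => X v s ω) T v : ℝ)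
                ≤ 20 * C * (Real.log n) ^ 2}) := by
  refine ⟨128 / MatchingAlgorithm.windowConst ^ 2,
    div_pos (by norm_num) (pow_pos MatchingAlgorithm.windowConst_pos 2), ?_⟩
  intro C hC V _ G ident hid n hn
  have hC0 : 0 ≤ C := le_trans (by positivity) hC
  have ht0 : 0 ≤ MatchingAlgorithm.tmax C n :=
    mul_nonneg (mul_nonneg hC0 n.cast_nonneg) (Real.log_natCast_nonneg n)
  refine ⟨3 * ⌊MatchingAlgorithm.tmax C n⌋₊, fun x => MatchingAlgorithm.matching G
    (MatchingAlgorithm.partners G (MatchingAlgorithm.roles C n x)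
      ⌊MatchingAlgorithm.tmax C n⌋₊), ?_, fun x => ?_, ?_⟩
  · have h := Nat.floor_le ht0
    have e : 3 * C * n * Real.log n = 3 * MatchingAlgorithm.tmax C n := by
      rw [MatchingAlgorithm.tmax]
      ring
    rw [e]
    push_cast
    linarith
  · have hfin := fun s hs v =>
      MatchingAlgorithm.config_final (G := G) (x := x) hid ht0 (s := s) hs v
    have hsymm := MatchingAlgorithm.partners_symm (G := G) (MatchingAlgorithm.roles C n x)
      ⌊MatchingAlgorithm.tmax C n⌋₊
    refine ⟨fun s hs v => ⟨?_, ?_, ?_⟩, MatchingAlgorithm.matching_isMatching _ _,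
      fun v w => ?_, fun v => ?_⟩
    · rw [hfin s hs v]
    · rw [hfin s hs v, hfin _ le_rfl v]
    · rw [MatchingAlgorithm.actionAt_eq, hfin s hs v]
      rfl
    · rw [hfin _ le_rfl v, MatchingAlgorithm.matching_adj_iff hsymm]
      exact ⟨fun h => Option.map_injective hid h, fun h => congrArg (Option.map ident) h⟩
    · rw [hfin _ le_rfl v, MatchingAlgorithm.mem_verts_matching_iff hsymm, not_not]
      exact Option.map_eq_none_iff
  · intro Ω _ P _ X hmeas hind hunif
    rcases Nat.lt_or_ge n 2 with h2 | h2
    · interval_cases n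
      · have := Fintype.card_eq_zero_iff.1 hn.symm
        refine le_of_le_of_eq (b := P.real Set.univ) (by simp)
          (congrArg P.real (Set.eq_univ_of_forall fun ω => ?_).symm)
        exact ⟨MatchingAlgorithm.matching_maximal (fun v => isEmptyElim v)
          fun v => isEmptyElim v, fun v => isEmptyElim v⟩
      · simp
    · exact MatchingAlgorithm.success_probability hid hn h2 hC hmeas hind hunif
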